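/- **Setting.** Let $d\ge 1$, $T=[0,1]^d$, and let $\|\cdot\|_\infty$ denote the maximum norm on $\mathbb R^d$ and the supremum norm of functions on $T$. For $\boldsymbol p=(p_1,\dots,p_d)\in\mathbb N^d$ put $\boldsymbol p_{\min}=\min_k p_k$ and $\boldsymbol p^{\boldsymbol 1}=\prod_k p_k$. Let design points $x_{\boldsymbol j}=(x_{1,j_1},\dots,x_{d,j_d})\in T$, $\boldsymbol 1\le\boldsymbol j\le\boldsymbol p$, with $x_{k,1}<\dots<x_{k,p_k}$ for every $k$ be given, and let $$Y_{i,\boldsymbol j}=\mu(x_{\boldsymbol j})+Z_i(x_{\boldsymbol j})+\varepsilon_{i,\boldsymbol j},\qquad 1\le i\le n,\ \boldsymbol 1\le\boldsymbol j\le\boldsymbol p .$$ Fix $\alpha>0$, $L>0$, $\beta_0\in(0,1]$, $C_Z>0$, $\zeta>0$, $\sigma\ge0$, $c,h_0>0$ and $C_1,C_2,C_3>0$, and let $\lfloor\alpha\rfloor$ be the largest integer in $\mathbb N_0$ that is strictly smaller than $\alpha$. * *Mean functions.* $\mathcal H(\alpha,L)$ is the class of functions $\mu:T\to\mathbb R$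 whose partial derivatives up to order $\lfloor\alpha\rfloor$ exist on $T$ and satisfy $$\max_{|\boldsymbol\beta|\le\lfloor\alpha\rfloor}\sup_{x\in T}|\partial^{\boldsymbol\beta}\mu(x)|+\max_{|\boldsymbol\beta|=\lfloor\alpha\rfloor}\sup_{x\ne y\in T}\frac{|\partial^{\boldsymbol\beta}\mu(x)-\partial^{\boldsymbol\beta}\mu(y)|}{\|x-y\|_\infty^{\alpha-\lfloor\alpha\rfloor}}\le L .$$ * *Processes.* $Z_1,\dots,Z_n$ are independent centered random fields on $T$, all distributed as a random field $Z\in\mathcal P_T(\beta_0,C_Z)$: there are $\beta\in[\beta_0,1]$ and a random variable $M>0$ with $\mathbb E[M^2]+\mathbb E[Z(0)^2]\le C_Z$ such that $|Z(x)-Z(y)|\le M\|x-y\|_\infty^{\beta}$ almost surely, for all $x,y\in T$. * *Errors.* The $\varepsilon_{i,\boldsymbol j}$ are independent, centered, independent of $(Z_1,\dots,Z_n)$, with variances $\sigma_{i,\boldsymbol j}^2\le\sigma^2$, and sub-Gaussian with variance proxy $\zeta^2\sigma_{i,\boldsymbol j}^2$, that is, $\mathbb E\,e^{t\varepsilon_{i,\boldsymbol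 j}}\le e^{\zeta^2\sigma_{i,\boldsymbol j}^2t^2/2}$ for all $t\in\mathbb R$. * *Design.* For all $h\in(c/\boldsymbol p_{\min},h_0]$ and $x\in T$, at most $C_3h^d\boldsymbol p^{\boldsymbol 1}$ of the indices $\boldsymbol j$ satisfy $\|x_{\boldsymbol j}-x\|_\infty\le h$. * *Weights.* The deterministic weights $w_{\boldsymbol j}(x;h)$, which may depend on the design, satisfy for all $h\in(c/\boldsymbol p_{\min},h_0]$ and all $x,y\in T$: (W1) $\sum_{\boldsymbol j}w_{\boldsymbol j}(x;h)=1$ and $\sum_{\boldsymbol j}(x_{\boldsymbol j}-x)^{\boldsymbol r}w_{\boldsymbol j}(x;h)=0$ for $\boldsymbol r\in\mathbb N_0^d$ with $1\le|\boldsymbol r|\le\lfloor\alpha\rfloor$; (W2) $w_{\boldsymbol j}(x;h)=0$ if $\|x_{\boldsymbol j}-x\|_\infty>h$; (W3) $|w_{\boldsymbol j}(x;h)|\le C_1/(\boldsymbol p^{\boldsymbol 1}h^d)$; (W4) $|w_{\boldsymbol j}(x;h)-w_{\boldsymbol j}(y;h)|\le\frac{C_2}{\boldsymbol p^{\boldsymbol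 1}h^d}\min\big(\|x-y\|_\infty/h,\,1\big)$. The estimator is $\widehat\mu_{n,\boldsymbol p,h}(x)=\sum_{\boldsymbol j}w_{\boldsymbol j}(x;h)\,\frac1n\sum_{i=1}^nY_{i,\boldsymbol j}$. **Theorem.** (a) There are constants $K$ and $N$, depending only on $d$ and on the constants fixed above, such that whenever $n\ge N$ and $\boldsymbol p_{\min}\ge N$, for all designs, weights, processes and errors as above, all $\mu\in\mathcal H(\alpha,L)$ and all $h\in(c/\boldsymbol p_{\min},h_0]$, $$\mathbb E\big[\|\widehat\mu_{n,\boldsymbol p,h}-\mu\|_\infty\big]\le K\,\max\Big(h^\alpha,\Big(\frac{\log(1/h)}{n\,\boldsymbol p^{\boldsymbol 1}h^d}\Big)^{1/2},n^{-1/2}\Big),$$ where the square root is read as $0$ if $h>1$. (b) Let $c'\ge c$ and $$h^\star=\max\Big(\frac{c'}{\boldsymbol p_{\min}},\Big(\frac{\log(n\boldsymbol p^{\boldsymbol 1})}{n\boldsymbol p^{\boldsymbol 1}}\Big)^{1/(2\alpha+d)}\Big);$$ if $c'=c$, assume in addition that (W1)–(W4) also hold for $h=c/\boldsymbol p_{\min}$.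 Then there are constants $K$ and $N$, depending only on $d$, $c'$ and the constants fixed above, such that whenever $n\ge N$ and $\boldsymbol p_{\min}\ge N$, for all designs, weights, processes and errors as above and all $\mu\in\mathcal H(\alpha,L)$, $$\mathbb E\big[\|\widehat\mu_{n,\boldsymbol p,h^\star}-\mu\|_\infty\big]\le K\,\max\Big(\boldsymbol p_{\min}^{-\alpha},\Big(\frac{\log(n\boldsymbol p^{\boldsymbol 1})}{n\boldsymbol p^{\boldsymbol 1}}\Big)^{\alpha/(2\alpha+d)},n^{-1/2}\Big).$$ -/

import Mathlib

open MeasureTheory ProbabilityTheory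
open scoped ENNReal NNReal

namespace MeanEst

noncomputable section

/-- The hypercube `T = [0,1]^d`, inside `Fin d → ℝ`, whose norm is the maximum norm. -/
abbrev cube (d : ℕ) : Set (Fin d → ℝ) := Set.Icc 0 1

/-- The origin, as a point of the cube. -/
def origin (d : ℕ) : cube d := ⟨0, Set.left_mem_Icc.2 zero_le_one⟩

/-- The multi-indices `𝟏 ≤ j ≤ p`. -/
abbrev Idx {d : ℕ} (p : Fin d → ℕ) : Type := (k : Fin d) → Fin (p k)

/-- `p_min`, the minimum of the coordinates of `p`. -/
def pMin {d : ℕ} (p : Fin d → ℕ) : ℕ := ⨅ k, p k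

/-- `p^𝟏`, the product of the coordinates of `p`, which is the number of design points. -/
def pProd {d : ℕ} (p : Fin d → ℕ) : ℕ := ∏ k, p k

/-! ### Hölder classes -/

/-- The largest integer in `ℕ₀` that is strictly smaller than `α > 0`. -/
def strictFloor (α : ℝ) : ℕ := ⌈α⌉₊ - 1

/-- The partial derivative `∂_{s 0} ⋯ ∂_{s (r-1)} f (x)` of order `r` on the closed cube
(one-sided at the boundary). For `f` of class `C^r` on the cube it only depends on how often each
coordinate occurs in `s`, that is, on the multi-index of `s`. -/
def partialDeriv {d : ℕ} (f : (Fin d → ℝ) → ℝ) {r : ℕ} (s : Fin r → Fin d) (x : Fin d → ℝ) : ℝ :=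
  iteratedFDerivWithin ℝ r f (cube d) x (fun i => Pi.single (s i) 1)

/-- The Hölder norm of index `α`, with values in `[0, ∞]`. -/
def holderNorm {d : ℕ} (α : ℝ) (f : (Fin d → ℝ) → ℝ) : ℝ≥0∞ :=
  (⨆ (r : ℕ) (_ : r ≤ strictFloor α) (s : Fin r → Fin d) (x : cube d), ‖partialDeriv f s x‖ₑ) +
  ⨆ (s : Fin (strictFloor α) → Fin d) (x : cube d) (y : cube d) (_ : x ≠ y),
    ‖partialDeriv f s x - partialDeriv f s y‖ₑ /
      ENNReal.ofReal (‖(x : Fin d → ℝ) - y‖ ^ (α - strictFloor α))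

/-- The Hölder class on the cube: only the values of `f` on the cube matter. If all partial
derivatives up to the order `strictFloor α` exist on the cube and those of top order are Hölder
continuous, then `f` is of class `C^(strictFloor α)` there, which is how existence of the
derivatives is expressed. -/
def HolderClass {d : ℕ} (α L : ℝ) : Set ((Fin d → ℝ) → ℝ) :=
  {f | ContDiffOn ℝ (strictFloor α : ℕ) f (cube d) ∧ holderNorm α f ≤ ENNReal.ofReal L}

/-! ### The class of processes -/

/-- The random field `Z` on the cube belongs to the class of processes with parameters
`β₀` and `C_Z`. -/
def InProcessClass {d : ℕ} {Ω : Type*} [MeasurableSpace Ω] (P : Measure Ω) (β₀ CZ : ℝ)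
    (Z : Ω → cube d → ℝ) : Prop :=
  (∀ x, Measurable fun ω => Z ω x) ∧
  ∃ β ∈ Set.Icc β₀ 1, ∃ M : Ω → ℝ, Measurable M ∧ (∀ᵐ ω ∂P, 0 < M ω) ∧
    MemLp M 2 P ∧ MemLp (fun ω => Z ω (origin d)) 2 P ∧
    (∫ ω, M ω ^ 2 ∂P) + (∫ ω, Z ω (origin d) ^ 2 ∂P) ≤ CZ ∧
    ∀ x y : cube d, ∀ᵐ ω ∂P, |Z ω x - Z ω y| ≤ M ω * ‖(x : Fin d → ℝ) - y‖ ^ β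

/-! ### Design, weights, model and estimator -/

/-- A design with Cartesian product structure: strictly increasing coordinates in `[0,1]`. -/
structure ProductDesign {d : ℕ} (p : Fin d → ℕ) where
  /-- the coordinates `x_{k,l}` -/
  coord : (k : Fin d) → Fin (p k) → ℝ
  strictMono : ∀ k, StrictMono (coord k)
  mem_Icc : ∀ k l, coord k l ∈ Set.Icc (0 : ℝ) 1

/-- The design point `x_j = (x_{1,j_1}, …, x_{d,j_d})`. -/
def ProductDesign.pt {d : ℕ} {p : Fin d → ℕ} (D : ProductDesign p) (j : Idx p) : cube d :=
  ⟨fun k => D.coord k (j k), fun k => (D.mem_Icc k (j k)).1, fun k => (D.mem_Icc k (j k)).2⟩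

/-- At most `C₃ h^d p^𝟏` design points lie in each box of centre `x ∈ T` and half side length `h`,
for all `h` in the range of bandwidths `(c / p_min, h₀]`. -/
def DesignCondition {d : ℕ} {p : Fin d → ℕ} (D : ProductDesign p) (c h₀ C₃ : ℝ) : Prop :=
  ∀ h ∈ Set.Ioc (c / pMin p) h₀, ∀ x : cube d,
    (Nat.card {j : Idx p // ∀ k, x.1 k - h ≤ (D.pt j).1 k ∧ (D.pt j).1 k ≤ x.1 k + h} : ℝ)
      ≤ C₃ * h ^ d * pProd p

/-- The conditions on the weights `w_j(x)` belonging to one bandwidth `h`: reproduction of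
polynomials up to the degree `γ`, localization, size, and Lipschitz continuity. -/
structure WeightConditions {d : ℕ} {p : Fin d → ℕ} (D : ProductDesign p) (γ : ℕ) (C₁ C₂ h : ℝ)
    (w : Idx p → cube d → ℝ) : Prop where
  sum_eq_one : ∀ x, ∑ j, w j x = 1
  sum_monomial : ∀ r : Fin d → ℕ, 1 ≤ ∑ k, r k → ∑ k, r k ≤ γ → ∀ x : cube d,
    ∑ j, (∏ k, ((D.pt j).1 k - x.1 k) ^ r k) * w j x = 0
  vanish : ∀ j (x : cube d), h < ‖((D.pt j : cube d) : Fin d → ℝ) - x‖ → w j x = 0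
  abs_le : ∀ j x, |w j x| ≤ C₁ / (pProd p * h ^ d)
  lipschitz : ∀ j (x y : cube d),
    |w j x - w j y| ≤ C₂ / (pProd p * h ^ d) * min (‖(x : Fin d → ℝ) - y‖ / h) 1

/-- The distributional assumptions: `Zs 0, …, Zs (n-1)` are independent centered random fields,
distributed as the generic `Z`, and the errors are independent, centered and independent of these
fields. Their variances are at most `σ²`, and `ζ²` times the variance of an error is an upper bound
for its sub-Gaussian parameter (variance proxy). -/
structure ModelAssumptions {d n : ℕ} {p : Fin d → ℕ}
    {Ω Ω' : Type*} [MeasurableSpace Ω] [MeasurableSpace Ω'] (P : Measure Ω) (P' : Measure Ω')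
    (ζ σ : ℝ) (Z : Ω' → cube d → ℝ) (Zs : Fin n → Ω → cube d → ℝ)
    (ε : Fin n → Idx p → Ω → ℝ) : Prop where
  measurable_field : ∀ i x, Measurable fun ω => Zs i ω x
  indep_field : iIndepFun Zs P
  identDistrib_field : ∀ i, IdentDistrib (Zs i) Z P P'
  centered_field : ∀ x, ∫ ω, Z ω x ∂P' = 0
  measurable_error : ∀ i j, Measurable (ε i j)
  indep_error : iIndepFun (fun ij : Fin n × Idx p => ε ij.1 ij.2) P
  indep_error_field : IndepFun (fun ω (ij : Fin n × Idx p) => ε ij.1 ij.2 ω) (fun ω i => Zs i ω) P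
  centered_error : ∀ i j, ∫ ω, ε i j ω ∂P = 0
  variance_error : ∀ i j, ∫ ω, ε i j ω ^ 2 ∂P ≤ σ ^ 2
  subgaussian_error : ∀ i j,
    HasSubgaussianMGF (ε i j) (ζ ^ 2 * ∫ ω, ε i j ω ^ 2 ∂P).toNNReal P

/-- The observations `Y_{i,j} = μ(x_j) + Z_i(x_j) + ε_{i,j}`. -/
def response {d n : ℕ} {p : Fin d → ℕ} {Ω : Type*} (D : ProductDesign p) (μ : (Fin d → ℝ) → ℝ)
    (Zs : Fin n → Ω → cube d → ℝ) (ε : Fin n → Idx p → Ω → ℝ) (i : Fin n) (j : Idx p) (ω : Ω) : ℝ :=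
  μ (D.pt j) + Zs i ω (D.pt j) + ε i j ω

/-- The linear estimator `∑ⱼ wⱼ(x) Ȳⱼ`, where `Ȳⱼ` is the average of `Y i j` over `i`. -/
def linearEstimator {d n : ℕ} {p : Fin d → ℕ} {Ω : Type*} (w : Idx p → cube d → ℝ)
    (Y : Fin n → Idx p → Ω → ℝ) (x : cube d) (ω : Ω) : ℝ :=
  ∑ j, w j x * ((1 / (n : ℝ)) * ∑ i, Y i j ω)

/-- The expected sup-norm error of the linear estimator, with values in `[0, ∞]`. -/
def expectedSupError {d n : ℕ} {p : Fin d → ℕ} {Ω : Type*} [MeasurableSpace Ω] (P : Measure Ω)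
    (D : ProductDesign p) (w : Idx p → cube d → ℝ) (μ : (Fin d → ℝ) → ℝ)
    (Zs : Fin n → Ω → cube d → ℝ) (ε : Fin n → Idx p → Ω → ℝ) : ℝ≥0∞ :=
  ∫⁻ ω, ⨆ x : cube d, ‖linearEstimator w (response D μ Zs ε) x ω - μ x‖ₑ ∂P

/-! ### Rates -/

/-- The bound `max (h^α, (log(1/h) / (n p^𝟏 h^d))^{1/2}, n^{-1/2})`; the square root of a negative
number (the case `h > 1`) is `0`. -/
def rate {d : ℕ} (α : ℝ) (n : ℕ) (p : Fin d → ℕ) (h : ℝ) : ℝ :=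
  max (h ^ α) (max (Real.sqrt (Real.log h⁻¹ / (n * pProd p * h ^ d))) ((n : ℝ) ^ (-(1 / 2) : ℝ)))

/-- The bandwidth `max (c / p_min, (log(n p^𝟏) / (n p^𝟏))^{1/(2α+d)})`. -/
def hStar {d : ℕ} (α c : ℝ) (n : ℕ) (p : Fin d → ℕ) : ℝ :=
  max (c / pMin p) ((Real.log (n * pProd p) / (n * pProd p)) ^ (1 / (2 * α + d)))

/-- The rate `max (p_min^{-α}, (log(n p^𝟏) / (n p^𝟏))^{α/(2α+d)}, n^{-1/2})`. -/
def optimalRate {d : ℕ} (α : ℝ) (n : ℕ) (p : Fin d → ℕ) : ℝ :=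
  max ((pMin p : ℝ) ^ (-α))
    (max ((Real.log (n * pProd p) / (n * pProd p)) ^ (α / (2 * α + d))) ((n : ℝ) ^ (-(1 / 2) : ℝ)))

end

end MeanEst

open MeanEst

/-!
The error of the estimator is the sum of a bias, a locally weighted average of the processes and a
locally weighted average of the errors. The weights reproduce polynomials, so that the bias only
sees the Taylor remainder of `μ` on a box of half side length `h`, which is of order `h ^ α`. The
sum of their absolute values is bounded, so that the second term is at most a constant times the
maximum of `1 / n ∑ᵢ Zᵢ` over the design points. Symmetrization replaces the processes by random
signs times fixed Hölder functions, and chaining along dyadic grids bounds the resulting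
sub-Gaussian maximum by a convergent series times `n ^ (-1 / 2)`, whatever the number of design
points. The third term is sub-Gaussian with variance of order `1 / (n p^𝟏 h ^ d)` at each point,
and Lipschitz continuity of the weights reduces its supremum to a maximum over a regular grid whose
cardinality is polynomial in `1 / h`; this produces the factor `log (1 / h)`. The bandwidth `h⋆`
balances the first term against the third.
-/

namespace MeanEst

open scoped BigOperators

/-! ### The sub-Gaussian maximal inequality -/

section MaximalInequality

variable {Ω : Type*} [MeasurableSpace Ω] {P : Measure Ω} {ι : Type*} [Fintype ι]

lemma hasSubgaussianMGF_mono {X : Ω → ℝ} {c c' : ℝ≥0} (h : HasSubgaussianMGF X c P)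
    (hc : c ≤ c') : HasSubgaussianMGF X c' P where
  integrable_exp_mul := h.integrable_exp_mul
  mgf_le t := (h.mgf_le t).trans <| by gcongr

lemma integrable_pi_norm {X : ι → Ω → ℝ} (hX : ∀ j, Integrable (X j) P) :
    Integrable (fun ω => ‖fun j => X j ω‖) P :=
  (Integrable.of_eval hX).norm

lemma exp_mul_pi_norm_le_sum [Nonempty ι] (x : ι → ℝ) {t : ℝ} (ht : 0 ≤ t) :
    Real.exp (t * ‖x‖) ≤ ∑ j, (Real.exp (t * x j) + Real.exp (-t * x j)) := by
  have hpos : 0 < ∑ j, (Real.exp (t * x j) + Real.exp (-t * x j)) :=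
    Finset.sum_pos (fun j _ => by positivity) Finset.univ_nonempty
  rw [← Real.le_log_iff_exp_le hpos, ← Real.norm_of_nonneg ht, ← norm_smul,
    pi_norm_le_iff_of_nonempty]
  intro j
  rw [Real.norm_of_nonneg ht, Real.le_log_iff_exp_le hpos]
  refine le_trans ?_ (Finset.single_le_sum
    (f := fun j => Real.exp (t * x j) + Real.exp (-t * x j)) (fun i _ => by positivity)
    (Finset.mem_univ j))
  rw [Pi.smul_apply, smul_eq_mul, Real.norm_eq_abs, neg_mul]
  exact Real.exp_abs_le (t * x j)

lemma integral_exp_add_exp_neg_le {X : Ω → ℝ} {c : ℝ≥0} (hX : HasSubgaussianMGF X c P) (t : ℝ) :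
    ∫ ω, (Real.exp (t * X ω) + Real.exp (-t * X ω)) ∂P ≤ 2 * Real.exp (c * t ^ 2 / 2) := by
  rw [integral_add (hX.integrable_exp_mul t) (hX.integrable_exp_mul (-t))]
  have hpos := hX.mgf_le t
  have hneg := hX.mgf_le (-t)
  simp only [mgf, neg_sq] at hpos hneg
  linarith

variable [IsProbabilityMeasure P]

/-- Jensen's inequality for `exp` turns a bound on the exponential moment into one on the mean. -/
lemma mul_integral_pi_norm_le [Nonempty ι] {X : ι → Ω → ℝ} {c : ℝ≥0}
    (hX : ∀ j, HasSubgaussianMGF (X j) c P) {t : ℝ} (ht : 0 ≤ t) :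
    t * ∫ ω, ‖fun j => X j ω‖ ∂P ≤ Real.log (2 * Fintype.card ι) + c * t ^ 2 / 2 := by
  have hnorm : Integrable (fun ω => t * ‖fun j => X j ω‖) P :=
    (integrable_pi_norm fun j => (hX j).integrable).const_mul t
  have hterm (j : ι) : Integrable (fun ω => Real.exp (t * X j ω) + Real.exp (-t * X j ω)) P :=
    ((hX j).integrable_exp_mul t).add ((hX j).integrable_exp_mul (-t))
  have hsum : Integrable
      (fun ω => ∑ j, (Real.exp (t * X j ω) + Real.exp (-t * X j ω))) P :=
    integrable_finsetSum _ fun j _ => hterm j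
  have hexp : Integrable (fun ω => Real.exp (t * ‖fun j => X j ω‖)) P :=
    hsum.mono' (Real.continuous_exp.comp_aestronglyMeasurable hnorm.aestronglyMeasurable) <|
      .of_forall fun ω => by
        simpa only [Real.norm_eq_abs, Real.abs_exp] using exp_mul_pi_norm_le_sum _ ht
  have hjensen : Real.exp (t * ∫ ω, ‖fun j => X j ω‖ ∂P) ≤
      2 * Fintype.card ι * Real.exp (c * t ^ 2 / 2) := by
    calc Real.exp (t * ∫ ω, ‖fun j => X j ω‖ ∂P)
        ≤ ∫ ω, Real.exp (t * ‖fun j => X j ω‖) ∂P := by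
          rw [← integral_const_mul]
          exact convexOn_exp.map_integral_le Real.continuous_exp.continuousOn isClosed_univ
            (.of_forall fun _ => Set.mem_univ _) hnorm hexp
      _ ≤ ∫ ω, ∑ j, (Real.exp (t * X j ω) + Real.exp (-t * X j ω)) ∂P :=
          integral_mono hexp hsum fun ω => exp_mul_pi_norm_le_sum _ ht
      _ ≤ ∑ _j : ι, 2 * Real.exp (c * t ^ 2 / 2) := by
          rw [integral_finsetSum _ fun j _ => hterm j]
          exact Finset.sum_le_sum fun j _ => integral_exp_add_exp_neg_le (hX j) t
      _ = 2 * Fintype.card ι * Real.exp (c * t ^ 2 / 2) := by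
          rw [Finset.sum_const, Finset.card_univ, nsmul_eq_mul]
          ring
  rwa [← Real.le_log_iff_exp_le (by positivity), Real.log_mul (by positivity) (by positivity),
    Real.log_exp] at hjensen

theorem integral_pi_norm_le [Nonempty ι] {X : ι → Ω → ℝ} {s : ℝ} (hs : 0 ≤ s)
    (hX : ∀ j, HasSubgaussianMGF (X j) (s ^ 2).toNNReal P) :
    ∫ ω, ‖fun j => X j ω‖ ∂P ≤ s * √(2 * Real.log (2 * Fintype.card ι)) := by
  set a := √(2 * Real.log (2 * Fintype.card ι))
  have hcard : (1 : ℝ) ≤ Fintype.card ι := by exact_mod_cast Fintype.card_pos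
  have hlog : 0 < Real.log (2 * Fintype.card ι) := Real.log_pos (by linarith)
  have hapos : 0 < a := Real.sqrt_pos.2 (by positivity)
  have hasq : a ^ 2 = 2 * Real.log (2 * Fintype.card ι) := Real.sq_sqrt (by positivity)
  rw [← div_le_iff₀ hapos]
  -- The exponent `t = a / r` balances the two terms for `r = s`, but is junk for `s = 0`.
  refine le_of_forall_gt_imp_ge_of_dense fun r hr => ?_
  have hr0 : 0 < r := hs.trans_lt hr
  have hproxy : (((s ^ 2).toNNReal : ℝ≥0) : ℝ) ≤ r ^ 2 := by
    rw [Real.coe_toNNReal _ (by positivity)]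
    gcongr
  rw [div_le_iff₀ hapos]
  refine le_of_mul_le_mul_left ?_ (div_pos hapos hr0)
  calc a / r * ∫ ω, ‖fun j => X j ω‖ ∂P
      ≤ Real.log (2 * Fintype.card ι) + r ^ 2 * (a / r) ^ 2 / 2 :=
        (mul_integral_pi_norm_le hX (by positivity)).trans (by gcongr)
    _ = a / r * (r * a) := by
        field_simp
        linarith

end MaximalInequality

/-! ### Random signs and symmetrization -/

section Signs

variable {ι κ : Type*} [Fintype ι]

lemma integral_uniformOfFintype [Nonempty ι] [MeasurableSpace ι] [MeasurableSingletonClass ι]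
    (f : ι → ℝ) : ∫ e, f e ∂(PMF.uniformOfFintype ι).toMeasure = 𝔼 e, f e := by
  rw [PMF.integral_eq_sum, Fintype.expect_eq_sum_div_card, Finset.sum_div]
  exact Finset.sum_congr rfl fun e _ => by simp [div_eq_inv_mul]

instance measurableSingletonClass_intUnits : MeasurableSingletonClass ℤˣ where
  measurableSet_singleton u := ⟨{(u : ℤ)}, measurableSet_singleton _, by
    ext v
    simp [Units.ext_iff]⟩

lemma sum_exp_units_smul_le (x : ℝ) :
    ∑ u : ℤˣ, Real.exp (u • x) ≤ 2 * Real.exp (x ^ 2 / 2) := by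
  have h := Real.cosh_le_exp_half_sq x
  rw [Real.cosh_eq] at h
  rw [UnitsInt.univ, Finset.sum_pair (by decide), one_smul, Units.neg_smul, one_smul]
  linarith

variable [DecidableEq ι]

lemma hasSubgaussianMGF_sum_units_smul (a : ι → ℝ) :
    HasSubgaussianMGF (fun e : ι → ℤˣ => ∑ i, e i • a i) (∑ i, a i ^ 2).toNNReal
      (PMF.uniformOfFintype (ι → ℤˣ)).toMeasure where
  integrable_exp_mul t := .of_finite
  mgf_le t := by
    rw [mgf, integral_uniformOfFintype, Real.coe_toNNReal _ (by positivity),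
      Fintype.expect_eq_sum_div_card, div_le_iff₀ (by positivity)]
    calc ∑ e : ι → ℤˣ, Real.exp (t * ∑ i, e i • a i)
        = ∏ i, ∑ u : ℤˣ, Real.exp (u • (t * a i)) := by
          rw [Finset.prod_univ_sum, Fintype.piFinset_univ]
          exact Finset.sum_congr rfl fun e _ => by
            simp only [Finset.mul_sum, Real.exp_sum, mul_smul_comm]
      _ ≤ ∏ i, 2 * Real.exp ((t * a i) ^ 2 / 2) :=
          Finset.prod_le_prod (fun i _ => by positivity) fun i _ => sum_exp_units_smul_le _
      _ = Real.exp ((∑ i, a i ^ 2) * t ^ 2 / 2) * Fintype.card (ι → ℤˣ) := by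
          rw [Finset.prod_mul_distrib, ← Real.exp_sum, mul_comm]
          simp only [mul_pow, ← Finset.sum_div, ← Finset.mul_sum, Finset.prod_const,
            Finset.card_univ, Fintype.card_pi, Fintype.card_units_int, Nat.cast_pow,
            Nat.cast_ofNat]
          ring_nf

theorem expect_pi_norm_sum_units_smul_le [Fintype κ] [Nonempty κ] {a : κ → ι → ℝ} {s : ℝ}
    (hs : 0 ≤ s) (ha : ∀ q, ∑ i, a q i ^ 2 ≤ s ^ 2) :
    𝔼 e : ι → ℤˣ, ‖fun q => ∑ i, e i • a q i‖ ≤ s * √(2 * Real.log (2 * Fintype.card κ)) := by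
  rw [← integral_uniformOfFintype]
  exact integral_pi_norm_le hs fun q => hasSubgaussianMGF_mono
    (hasSubgaussianMGF_sum_units_smul (a q)) (Real.toNNReal_le_toNNReal (ha q))

end Signs

section Symmetrization

variable {Ω : Type*} [MeasurableSpace Ω] {P : Measure Ω} [IsProbabilityMeasure P]
  {E : Type*} [NormedAddCommGroup E] [NormedSpace ℝ E] [CompleteSpace E] [MeasurableSpace E]
  [BorelSpace E] [SecondCountableTopology E]

/-- Given `X = x`, this is Jensen's inequality `‖x‖ = ‖𝔼[x + Y]‖ ≤ 𝔼‖x + Y‖`. -/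
lemma integral_norm_le_integral_norm_add {X Y : Ω → E} (hXY : IndepFun X Y P)
    (hX : Integrable X P) (hY : Integrable Y P) (hmX : Measurable X) (hmY : Measurable Y)
    (hY0 : ∫ ω, Y ω ∂P = 0) : ∫ ω, ‖X ω‖ ∂P ≤ ∫ ω, ‖X ω + Y ω‖ ∂P := by
  have hmap := (indepFun_iff_map_prod_eq_prod_map_map hmX.aemeasurable hmY.aemeasurable).1 hXY
  have : IsProbabilityMeasure (P.map X) := Measure.isProbabilityMeasure_map hmX.aemeasurable
  have : IsProbabilityMeasure (P.map Y) := Measure.isProbabilityMeasure_map hmY.aemeasurable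
  have hadd : StronglyMeasurable fun z : E × E => ‖z.1 + z.2‖ :=
    (continuous_fst.add continuous_snd).norm.stronglyMeasurable
  have hint : Integrable (fun z : E × E => ‖z.1 + z.2‖) ((P.map X).prod (P.map Y)) := by
    rw [← hmap, integrable_map_measure hadd.aestronglyMeasurable (hmX.prodMk hmY).aemeasurable]
    exact (hX.add hY).norm
  have hidX : Integrable (fun y : E => y) (P.map X) :=
    (integrable_map_measure aestronglyMeasurable_id hmX.aemeasurable).2 hX
  have hidY : Integrable (fun y : E => y) (P.map Y) :=
    (integrable_map_measure aestronglyMeasurable_id hmY.aemeasurable).2 hY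
  have hidY0 : ∫ y, y ∂(P.map Y) = 0 :=
    (integral_map hmY.aemeasurable aestronglyMeasurable_id).trans hY0
  calc ∫ ω, ‖X ω‖ ∂P = ∫ x, ‖x‖ ∂(P.map X) :=
        (integral_map hmX.aemeasurable continuous_norm.aestronglyMeasurable).symm
    _ ≤ ∫ x, ∫ y, ‖x + y‖ ∂(P.map Y) ∂(P.map X) := by
        refine integral_mono hidX.norm hint.integral_prod_left fun x => ?_
        have h := norm_integral_le_integral_norm (μ := P.map Y) (fun y => x + y)
        rw [integral_add (integrable_const _) hidY, hidY0] at h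
        simpa using h
    _ = ∫ z, ‖z.1 + z.2‖ ∂((P.map X).prod (P.map Y)) := (integral_prod _ hint).symm
    _ = ∫ ω, ‖X ω + Y ω‖ ∂P := by
        rw [← hmap, integral_map (hmX.prodMk hmY).aemeasurable hadd.aestronglyMeasurable]

omit [IsProbabilityMeasure P] [NormedSpace ℝ E] [CompleteSpace E] in
lemma indepFun_sum_sum_of_disjoint {ι : Type*} {X : ι → Ω → E} (hind : iIndepFun X P)
    (hm : ∀ i, Measurable (X i)) {A B : Finset ι} (hAB : Disjoint A B) :
    IndepFun (fun ω => ∑ i ∈ A, X i ω) (fun ω => ∑ i ∈ B, X i ω) P := by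
  have hmeas (S : Finset ι) : Measurable fun f : S → E => ∑ i, f i :=
    Finset.measurable_fun_sum _ fun i _ => measurable_pi_apply i
  have h := (hind.indepFun_finset A B hAB hm).comp (hmeas A) (hmeas B)
  convert h using 2 <;> exact (Finset.sum_coe_sort _ _).symm

variable {ι : Type*} [Fintype ι] {X : ι → Ω → E}

/-- The terms with sign `1` and those with sign `-1` form independent centered sums, so that
dropping either of them decreases the expected norm. -/
lemma integral_norm_sum_le_two_mul_integral_norm_sum_units_smul (hind : iIndepFun X P)
    (hm : ∀ i, Measurable (X i)) (hint : ∀ i, Integrable (X i) P)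
    (hX0 : ∀ i, ∫ ω, X i ω ∂P = 0) (e : ι → ℤˣ) :
    ∫ ω, ‖∑ i, X i ω‖ ∂P ≤ 2 * ∫ ω, ‖∑ i, e i • X i ω‖ ∂P := by
  classical
  set A : Finset ι := {i | e i = 1} with hA
  set U : Finset ι → Ω → E := fun B ω => ∑ i ∈ B, X i ω
  have hmU B : Measurable (U B) := Finset.measurable_fun_sum _ fun i _ => hm i
  have hiU B : Integrable (U B) P := integrable_finsetSum _ fun i _ => hint i
  have hU0 B : ∫ ω, U B ω ∂P = 0 := by
    rw [integral_finsetSum _ fun i _ => hint i]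
    exact Finset.sum_eq_zero fun i _ => hX0 i
  have hindU : IndepFun (U A) (U Aᶜ) P :=
    indepFun_sum_sum_of_disjoint hind hm disjoint_compl_right
  have hsign ω : ∑ i, e i • X i ω = U A ω + -U Aᶜ ω := by
    rw [← Finset.sum_add_sum_compl A, ← Finset.sum_neg_distrib]
    congr 1 <;> refine Finset.sum_congr rfl fun i hi => ?_
    · rw [(Finset.mem_filter.1 hi).2, one_smul]
    · have hi' : e i ≠ 1 := by simpa [hA] using hi
      rw [(Int.units_eq_one_or (e i)).resolve_left hi', Units.neg_smul, one_smul]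
  have hpos : ∫ ω, ‖U A ω‖ ∂P ≤ ∫ ω, ‖∑ i, e i • X i ω‖ ∂P := by
    simp_rw [hsign]
    refine integral_norm_le_integral_norm_add (hindU.comp measurable_id measurable_neg)
      (hiU A) (hiU Aᶜ).neg (hmU A) (hmU Aᶜ).neg ?_
    exact (integral_neg _).trans (by rw [hU0, neg_zero])
  have hneg : ∫ ω, ‖U Aᶜ ω‖ ∂P ≤ ∫ ω, ‖∑ i, e i • X i ω‖ ∂P := by
    simp_rw [hsign]
    have h := integral_norm_le_integral_norm_add (hindU.symm.comp measurable_neg measurable_id)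
      (hiU Aᶜ).neg (hiU A) (hmU Aᶜ).neg (hmU A) (hU0 A)
    simpa [add_comm] using h
  calc ∫ ω, ‖∑ i, X i ω‖ ∂P ≤ ∫ ω, (‖U A ω‖ + ‖U Aᶜ ω‖) ∂P := by
        refine integral_mono (integrable_finsetSum _ fun i _ => hint i).norm
          ((hiU A).norm.add (hiU Aᶜ).norm) fun ω => ?_
        simp only [← Finset.sum_add_sum_compl A]
        exact norm_add_le _ _
    _ = ∫ ω, ‖U A ω‖ ∂P + ∫ ω, ‖U Aᶜ ω‖ ∂P := integral_add (hiU A).norm (hiU Aᶜ).norm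
    _ ≤ 2 * ∫ ω, ‖∑ i, e i • X i ω‖ ∂P := by linarith

theorem integral_norm_sum_le_two_mul_integral_of_expect_le [DecidableEq ι] (hind : iIndepFun X P)
    (hm : ∀ i, Measurable (X i)) (hint : ∀ i, Integrable (X i) P)
    (hX0 : ∀ i, ∫ ω, X i ω ∂P = 0) {B : Ω → ℝ} (hB : Integrable B P)
    (hle : ∀ ω, 𝔼 e : ι → ℤˣ, ‖∑ i, e i • X i ω‖ ≤ B ω) :
    ∫ ω, ‖∑ i, X i ω‖ ∂P ≤ 2 * ∫ ω, B ω ∂P := by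
  have hi (e : ι → ℤˣ) : Integrable (fun ω => ‖∑ i, e i • X i ω‖) P := by
    refine (integrable_finsetSum _ fun i _ => ?_).norm
    rcases Int.units_eq_one_or (e i) with h | h
    · simpa only [h, one_smul] using hint i
    · simp only [h, Units.neg_smul, one_smul]
      exact (hint i).neg
  calc ∫ ω, ‖∑ i, X i ω‖ ∂P
      ≤ 𝔼 e : ι → ℤˣ, 2 * ∫ ω, ‖∑ i, e i • X i ω‖ ∂P :=
        Finset.le_expect Finset.univ_nonempty fun e _ =>
          integral_norm_sum_le_two_mul_integral_norm_sum_units_smul hind hm hint hX0 e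
    _ = 2 * ∫ ω, 𝔼 e : ι → ℤˣ, ‖∑ i, e i • X i ω‖ ∂P := by
        rw [← Finset.mul_expect]
        simp only [Fintype.expect_eq_sum_div_card]
        rw [integral_div, integral_finsetSum _ fun e _ => hi e]
    _ ≤ 2 * ∫ ω, B ω ∂P := by
        refine mul_le_mul_of_nonneg_left (integral_mono ?_ hB hle) zero_le_two
        simp only [Fintype.expect_eq_sum_div_card]
        exact (integrable_finsetSum _ fun e _ => hi e).div_const _

end Symmetrization

/-! ### Taylor expansion on the cube -/

section Taylor

variable {d : ℕ} {f : (Fin d → ℝ) → ℝ}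

lemma uniqueDiffOn_cube : UniqueDiffOn ℝ (cube d) := by
  have h : cube d = Set.univ.pi fun _ : Fin d => Set.Icc (0 : ℝ) 1 := by
    rw [Set.pi_univ_Icc]
    rfl
  rw [h]
  exact UniqueDiffOn.univ_pi fun _ => uniqueDiffOn_Icc zero_lt_one

lemma add_smul_sub_mem_cube (x y : cube d) {t : ℝ} (ht : t ∈ Set.Icc (0 : ℝ) 1) :
    x.1 + t • (y.1 - x.1) ∈ cube d :=
  (convex_Icc (0 : Fin d → ℝ) 1).add_smul_sub_mem x.2 y.2 ht

/-- The term `D^r f(z)[v, …, v] / r!` of order `r` in the Taylor expansion of `f` on the cube, for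
the increment `v`. It is written with ordered tuples of directions instead of multi-indices. -/
noncomputable def taylorTerm (f : (Fin d → ℝ) → ℝ) (r : ℕ) (z v : Fin d → ℝ) : ℝ :=
  (r.factorial : ℝ)⁻¹ * ∑ s : Fin r → Fin d, (∏ i, v (s i)) * partialDeriv f s z

lemma taylorTerm_zero (f : (Fin d → ℝ) → ℝ) (z v : Fin d → ℝ) : taylorTerm f 0 z v = f z := by
  simp [taylorTerm, partialDeriv]

lemma iteratedFDerivWithin_cube_apply_const (f : (Fin d → ℝ) → ℝ) (r : ℕ) (z v : Fin d → ℝ) :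
    iteratedFDerivWithin ℝ r f (cube d) z (fun _ => v) = r.factorial * taylorTerm f r z v := by
  have hv : v = ∑ k, v k • (Pi.single k (1 : ℝ) : Fin d → ℝ) := by
    simpa using pi_eq_sum_univ' v
  rw [taylorTerm, mul_inv_cancel_left₀ (Nat.cast_ne_zero.2 r.factorial_ne_zero)]
  conv_lhs => rw [hv]
  rw [ContinuousMultilinearMap.map_sum]
  refine Finset.sum_congr rfl fun s _ => ?_
  rw [ContinuousMultilinearMap.map_smul_univ]
  rfl

lemma iteratedDerivWithin_comp_segment {l : ℕ} (hf : ContDiffOn ℝ l f (cube d)) (x y : cube d)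
    {r : ℕ} (hr : r ≤ l) {t : ℝ} (ht : t ∈ Set.Icc (0 : ℝ) 1) :
    iteratedDerivWithin r (fun u : ℝ => f (x.1 + u • (y.1 - x.1))) (Set.Icc 0 1) t =
      iteratedFDerivWithin ℝ r f (cube d) (x.1 + t • (y.1 - x.1)) (fun _ => y.1 - x.1) := by
  induction r generalizing t with
  | zero => simp
  | succ r ih =>
    rw [iteratedDerivWithin_succ, derivWithin_congr (fun u hu => ih (by lia) hu) (ih (by lia) ht)]
    have hderiv : HasFDerivWithinAt (iteratedFDerivWithin ℝ r f (cube d))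
        (fderivWithin ℝ (iteratedFDerivWithin ℝ r f (cube d)) (cube d)
          (x.1 + t • (y.1 - x.1))) (cube d) (x.1 + t • (y.1 - x.1)) :=
      (hf.differentiableOn_iteratedFDerivWithin (by exact_mod_cast hr) uniqueDiffOn_cube _
        (add_smul_sub_mem_cube x y ht)).hasFDerivWithinAt
    have hline : HasDerivWithinAt (fun u : ℝ => x.1 + u • (y.1 - x.1)) (y.1 - x.1)
        (Set.Icc 0 1) t := by
      simpa using (((hasDerivAt_id t).smul_const (y.1 - x.1)).const_add x.1).hasDerivWithinAt
    have hcomp := ((ContinuousMultilinearMap.apply ℝ (fun _ : Fin r => Fin d → ℝ) ℝ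
      (fun _ => y.1 - x.1)).hasFDerivAt).comp_hasDerivWithinAt t
        (hderiv.comp_hasDerivWithinAt t hline fun u hu => add_smul_sub_mem_cube x y hu)
    rw [iteratedFDerivWithin_succ_apply_left]
    exact hcomp.derivWithin (uniqueDiffOn_Icc zero_lt_one t ht)

theorem exists_eq_sum_taylorTerm_add {l : ℕ} (hf : ContDiffOn ℝ l f (cube d)) (x y : cube d) :
    ∃ ξ ∈ Set.Icc (0 : ℝ) 1, f y = ∑ r ∈ Finset.range l, taylorTerm f r x (y.1 - x.1) +
      taylorTerm f l (x.1 + ξ • (y.1 - x.1)) (y.1 - x.1) := by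
  rcases l with _ | l
  · exact ⟨1, Set.right_mem_Icc.2 zero_le_one, by simp [taylorTerm_zero]⟩
  set g : ℝ → ℝ := fun u => f (x.1 + u • (y.1 - x.1)) with hg
  have hIcc : Set.uIcc (0 : ℝ) 1 = Set.Icc 0 1 := Set.uIcc_of_le zero_le_one
  have hIoo : Set.uIoo (0 : ℝ) 1 = Set.Ioo 0 1 := Set.uIoo_of_le zero_le_one
  have hgC : ContDiffOn ℝ (l + 1 : ℕ) g (Set.Icc 0 1) :=
    hf.comp (t := cube d) (by fun_prop) fun u hu => add_smul_sub_mem_cube x y hu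
  have hder {r : ℕ} (hr : r ≤ l + 1) {t : ℝ} (ht : t ∈ Set.Icc (0 : ℝ) 1) :
      iteratedDerivWithin r g (Set.Icc 0 1) t =
        r.factorial * taylorTerm f r (x.1 + t • (y.1 - x.1)) (y.1 - x.1) := by
    rw [iteratedDerivWithin_comp_segment hf x y hr ht, iteratedFDerivWithin_cube_apply_const]
  obtain ⟨ξ, hξ, htaylor⟩ := taylor_mean_remainder_lagrange (f := g) (x := 1) (x₀ := 0) (n := l)
    zero_ne_one (by rw [hIcc]; exact hgC.of_le (by exact_mod_cast l.le_succ)) (by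
      rw [hIcc, hIoo]
      exact (hgC.differentiableOn_iteratedDerivWithin (by exact_mod_cast l.lt_succ_self)
        (uniqueDiffOn_Icc zero_lt_one)).mono Set.Ioo_subset_Icc_self)
  have hξ' : ξ ∈ Set.Icc (0 : ℝ) 1 := Set.Ioo_subset_Icc_self (hIoo ▸ hξ)
  refine ⟨ξ, hξ', ?_⟩
  have hg1 : g 1 = f y := by simp [hg]
  rw [hIcc, taylor_within_apply, hder le_rfl hξ', sub_eq_iff_eq_add', hg1] at htaylor
  rw [htaylor]
  congr 1
  · refine Finset.sum_congr rfl fun r hr => ?_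
    rw [hder (Finset.mem_range.1 hr).le (Set.left_mem_Icc.2 zero_le_one)]
    simp [Nat.factorial_ne_zero]
  · simp [Nat.factorial_ne_zero, mul_div_cancel_left₀]

variable {α L : ℝ}

lemma strictFloor_lt (hα : 0 < α) : (strictFloor α : ℝ) < α := by
  have hceil : 0 < ⌈α⌉₊ := Nat.ceil_pos.2 hα
  rw [strictFloor, Nat.cast_sub hceil, Nat.cast_one, sub_lt_iff_lt_add]
  exact Nat.ceil_lt_add_one hα.le

lemma abs_partialDeriv_sub_le (hL : 0 ≤ L) (hf : f ∈ HolderClass (d := d) α L)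
    (s : Fin (strictFloor α) → Fin d) (x y : cube d) :
    |partialDeriv f s x - partialDeriv f s y| ≤ L * ‖x.1 - y.1‖ ^ (α - strictFloor α) := by
  rcases eq_or_ne x y with rfl | hxy
  · rw [sub_self, abs_zero]
    positivity
  have hquot : ‖partialDeriv f s x - partialDeriv f s y‖ₑ /
      ENNReal.ofReal (‖(x : Fin d → ℝ) - y‖ ^ (α - strictFloor α)) ≤ ENNReal.ofReal L := by
    refine le_trans ?_ ((le_add_left le_rfl).trans hf.2)
    exact le_iSup_of_le s (le_iSup_of_le x (le_iSup_of_le y (le_iSup_of_le hxy le_rfl)))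
  have hpos : 0 < ‖(x : Fin d → ℝ) - y‖ ^ (α - strictFloor α) :=
    Real.rpow_pos_of_pos (norm_pos_iff.2 (sub_ne_zero.2 (Subtype.coe_ne_coe.2 hxy))) _
  rwa [ENNReal.div_le_iff (by simpa using hpos) ENNReal.ofReal_ne_top, ← ENNReal.ofReal_mul hL,
    ← ofReal_norm, ENNReal.ofReal_le_ofReal_iff (by positivity)] at hquot

lemma abs_taylorTerm_sub_le (hL : 0 ≤ L) (hf : f ∈ HolderClass (d := d) α L) (z x : cube d)
    (v : Fin d → ℝ) :
    |taylorTerm f (strictFloor α) z v - taylorTerm f (strictFloor α) x v| ≤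
      d ^ strictFloor α * L * (‖v‖ ^ strictFloor α * ‖z.1 - x.1‖ ^ (α - strictFloor α)) := by
  set l := strictFloor α
  have hprod (s : Fin l → Fin d) : ∏ i, |v (s i)| ≤ ‖v‖ ^ l := by
    simpa using Finset.prod_le_prod (s := Finset.univ) (fun _ _ => abs_nonneg _)
      fun i _ => norm_le_pi_norm v (s i)
  rw [taylorTerm, taylorTerm, ← mul_sub, ← Finset.sum_sub_distrib, abs_mul,
    abs_of_nonneg (by positivity)]
  refine (mul_le_of_le_one_left (abs_nonneg _)
    (inv_le_one_of_one_le₀ (by exact_mod_cast l.factorial_pos))).trans ?_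
  calc |∑ s : Fin l → Fin d,
        ((∏ i, v (s i)) * partialDeriv f s z - (∏ i, v (s i)) * partialDeriv f s x)|
      ≤ ∑ s : Fin l → Fin d, (∏ i, |v (s i)|) * |partialDeriv f s z - partialDeriv f s x| := by
        refine (Finset.abs_sum_le_sum_abs _ _).trans_eq (Finset.sum_congr rfl fun s _ => ?_)
        rw [← mul_sub, abs_mul, Finset.abs_prod]
    _ ≤ ∑ _s : Fin l → Fin d, ‖v‖ ^ l * (L * ‖z.1 - x.1‖ ^ (α - l)) := by
        refine Finset.sum_le_sum fun s _ => ?_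
        exact mul_le_mul (hprod s) (abs_partialDeriv_sub_le hL hf s z x) (abs_nonneg _)
          (by positivity)
    _ = d ^ l * L * (‖v‖ ^ l * ‖z.1 - x.1‖ ^ (α - l)) := by
        simp only [Finset.sum_const, Finset.card_univ, Fintype.card_pi, Fintype.card_fin,
          Finset.prod_const, nsmul_eq_mul, Nat.cast_pow]
        ring

theorem abs_sub_sum_taylorTerm_le (hα : 0 < α) (hL : 0 ≤ L) (hf : f ∈ HolderClass (d := d) α L)
    (x y : cube d) :
    |f y - ∑ r ∈ Finset.range (strictFloor α + 1), taylorTerm f r x (y.1 - x.1)| ≤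
      d ^ strictFloor α * L * ‖y.1 - x.1‖ ^ α := by
  obtain ⟨ξ, hξ, htaylor⟩ := exists_eq_sum_taylorTerm_add hf.1 x y
  have hlα : 0 ≤ α - strictFloor α := (sub_pos.2 (strictFloor_lt hα)).le
  have hξx : ‖x.1 + ξ • (y.1 - x.1) - x.1‖ ≤ ‖y.1 - x.1‖ := by
    rw [add_sub_cancel_left, norm_smul, Real.norm_of_nonneg hξ.1]
    exact mul_le_of_le_one_left (norm_nonneg _) hξ.2
  rw [Finset.sum_range_succ, htaylor, add_sub_add_left_eq_sub]
  calc |taylorTerm f (strictFloor α) (x.1 + ξ • (y.1 - x.1)) (y.1 - x.1) -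
        taylorTerm f (strictFloor α) x (y.1 - x.1)|
      ≤ d ^ strictFloor α * L * (‖y.1 - x.1‖ ^ strictFloor α *
          ‖x.1 + ξ • (y.1 - x.1) - x.1‖ ^ (α - strictFloor α)) :=
        abs_taylorTerm_sub_le hL hf ⟨_, add_smul_sub_mem_cube x y hξ⟩ x _
    _ ≤ d ^ strictFloor α * L * (‖y.1 - x.1‖ ^ strictFloor α *
          ‖y.1 - x.1‖ ^ (α - strictFloor α)) := by gcongr
    _ = d ^ strictFloor α * L * ‖y.1 - x.1‖ ^ α := by
        rw [← Real.rpow_natCast ‖y.1 - x.1‖,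
          ← Real.rpow_add_of_nonneg (norm_nonneg _) (Nat.cast_nonneg _) hlα,
          add_sub_cancel]

end Taylor

/-! ### Local weights and the bias -/

section Weights

variable {d : ℕ} {J : Type*}

/-- The conditions (W1)–(W4) on the weights belonging to one bandwidth `h`, for an arbitrary
finite family `pt` of design points and with a real number `m` as normalization, in place of the
number `p^𝟏` of points of a product design. -/
structure LocalWeights [Fintype J] (pt : J → cube d) (γ : ℕ) (C₁ C₂ m h : ℝ)
    (w : J → cube d → ℝ) : Prop where
  sum_eq_one : ∀ x, ∑ j, w j x = 1
  sum_monomial : ∀ r : Fin d → ℕ, 1 ≤ ∑ k, r k → ∑ k, r k ≤ γ → ∀ x : cube d,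
    ∑ j, (∏ k, ((pt j).1 k - x.1 k) ^ r k) * w j x = 0
  vanish : ∀ j (x : cube d), h < ‖(pt j).1 - x.1‖ → w j x = 0
  abs_le : ∀ j x, |w j x| ≤ C₁ / (m * h ^ d)
  lipschitz : ∀ j (x y : cube d),
    |w j x - w j y| ≤ C₂ / (m * h ^ d) * min (‖x.1 - y.1‖ / h) 1

/-- At most `C h^d m` of the design points lie within distance `h` of any point of the cube. -/
def SparseDesign (pt : J → cube d) (C m h : ℝ) : Prop :=
  ∀ x : cube d, (Nat.card {j // ‖(pt j).1 - x.1‖ ≤ h} : ℝ) ≤ C * h ^ d * m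

variable [Fintype J] {pt : J → cube d} {γ : ℕ} {C₁ C₂ C₃ m h : ℝ} {w : J → cube d → ℝ}

lemma SparseDesign.sum_le (hpt : SparseDesign pt C₃ m h) {x : cube d} {f : J → ℝ} {b : ℝ}
    (hb : 0 ≤ b) (hle : ∀ j, f j ≤ b) (hf : ∀ j, h < ‖(pt j).1 - x.1‖ → f j = 0) :
    ∑ j, f j ≤ b * (C₃ * h ^ d * m) := by
  classical
  set B : Finset J := {j | ‖(pt j).1 - x.1‖ ≤ h} with hB
  have hcard : (B.card : ℝ) ≤ C₃ * h ^ d * m := by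
    rw [hB, ← Fintype.card_subtype, ← Nat.card_eq_fintype_card]
    exact hpt x
  calc ∑ j, f j = ∑ j ∈ B, f j :=
        (Finset.sum_subset (Finset.subset_univ B) fun j _ hj =>
          hf j (by simpa [hB] using hj)).symm
    _ ≤ b * B.card := by simpa [mul_comm] using Finset.sum_le_sum fun j (_ : j ∈ B) => hle j
    _ ≤ b * (C₃ * h ^ d * m) := by gcongr

namespace LocalWeights

variable (hw : LocalWeights pt γ C₁ C₂ m h w)
include hw

lemma sum_abs_le (hpt : SparseDesign pt C₃ m h) (hC₁ : 0 ≤ C₁) (hm : 0 < m) (hh : 0 < h)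
    (x : cube d) : ∑ j, |w j x| ≤ C₁ * C₃ := by
  refine (hpt.sum_le (b := C₁ / (m * h ^ d)) (by positivity) (fun j => hw.abs_le j x)
    fun j hj => by rw [hw.vanish j x hj, abs_zero]).trans_eq ?_
  field_simp

lemma sum_sq_le (hpt : SparseDesign pt C₃ m h) (hm : 0 < m) (hh : 0 < h) (x : cube d) :
    ∑ j, w j x ^ 2 ≤ C₁ ^ 2 * C₃ / (m * h ^ d) := by
  refine (hpt.sum_le (b := (C₁ / (m * h ^ d)) ^ 2) (by positivity) (fun j => ?_)
    fun j hj => by rw [hw.vanish j x hj, zero_pow two_ne_zero]).trans_eq (by field_simp)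
  exact (sq_abs _).symm.trans_le (pow_le_pow_left₀ (abs_nonneg _) (hw.abs_le j x) 2)

lemma abs_sub_le (hC₂ : 0 ≤ C₂) (hm : 0 < m) (hh : 0 < h) (j : J) (x y : cube d) :
    |w j x - w j y| ≤ C₂ / (m * h ^ (d + 1)) * ‖x.1 - y.1‖ := by
  refine (hw.lipschitz j x y).trans ?_
  calc C₂ / (m * h ^ d) * min (‖x.1 - y.1‖ / h) 1
      ≤ C₂ / (m * h ^ d) * (‖x.1 - y.1‖ / h) := by gcongr; exact min_le_left _ _
    _ = C₂ / (m * h ^ (d + 1)) * ‖x.1 - y.1‖ := by rw [pow_succ]; field_simp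

lemma sum_mul_prod_eq_zero {r : ℕ} (hr : 1 ≤ r) (hrγ : r ≤ γ) (s : Fin r → Fin d) (x : cube d) :
    ∑ j, w j x * ∏ i, ((pt j).1 - x.1) (s i) = 0 := by
  classical
  set multiplicity : Fin d → ℕ := fun k => Finset.card {i | s i = k}
  have hsum : ∑ k, multiplicity k = r := by
    simpa using (Finset.card_eq_sum_card_fiberwise (f := s) (s := Finset.univ) (t := Finset.univ)
      (by simp)).symm
  rw [← hw.sum_monomial multiplicity (by rwa [hsum]) (by rwa [hsum]) x]
  refine Finset.sum_congr rfl fun j _ => ?_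
  rw [mul_comm, ← Finset.prod_fiberwise' Finset.univ s fun k => ((pt j).1 - x.1) k]
  simp only [Finset.prod_const, Pi.sub_apply, multiplicity]

lemma sum_mul_taylorTerm_eq_zero {r : ℕ} (hr : 1 ≤ r) (hrγ : r ≤ γ) (f : (Fin d → ℝ) → ℝ)
    (x : cube d) : ∑ j, w j x * taylorTerm f r x ((pt j).1 - x.1) = 0 := by
  calc ∑ j, w j x * taylorTerm f r x ((pt j).1 - x.1)
      = ∑ s : Fin r → Fin d, (r.factorial : ℝ)⁻¹ * partialDeriv f s x *
          ∑ j, w j x * ∏ i, ((pt j).1 - x.1) (s i) := by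
        simp only [taylorTerm, Finset.mul_sum]
        rw [Finset.sum_comm]
        exact Finset.sum_congr rfl fun s _ => Finset.sum_congr rfl fun j _ => by ring
    _ = 0 := Finset.sum_eq_zero fun s _ => by rw [hw.sum_mul_prod_eq_zero hr hrγ, mul_zero]

lemma sum_mul_sum_taylorTerm (f : (Fin d → ℝ) → ℝ) (x : cube d) :
    ∑ j, w j x * ∑ r ∈ Finset.range (γ + 1), taylorTerm f r x ((pt j).1 - x.1) = f x := by
  simp only [Finset.mul_sum]
  rw [Finset.sum_comm, Finset.sum_range_succ', Finset.sum_eq_zero fun r hr =>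
    hw.sum_mul_taylorTerm_eq_zero r.succ_pos (Finset.mem_range.1 hr) f x]
  simp only [taylorTerm_zero, ← Finset.sum_mul, hw.sum_eq_one, one_mul, zero_add]

end LocalWeights

theorem abs_sum_mul_sub_le_sum_abs_mul {α L : ℝ} {f : (Fin d → ℝ) → ℝ} (hα : 0 < α) (hL : 0 ≤ L)
    (hf : f ∈ HolderClass (d := d) α L) (hw : LocalWeights pt (strictFloor α) C₁ C₂ m h w)
    (x : cube d) :
    |∑ j, w j x * f (pt j) - f x| ≤ (∑ j, |w j x|) * (d ^ strictFloor α * L * h ^ α) := by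
  set T : J → ℝ := fun j =>
    ∑ r ∈ Finset.range (strictFloor α + 1), taylorTerm f r x ((pt j).1 - x.1)
  have hT : ∑ j, w j x * f (pt j) - f x = ∑ j, w j x * (f (pt j) - T j) := by
    rw [← hw.sum_mul_sum_taylorTerm f x, ← Finset.sum_sub_distrib]
    exact Finset.sum_congr rfl fun j _ => (mul_sub _ _ _).symm
  rw [hT, Finset.sum_mul]
  refine (Finset.abs_sum_le_sum_abs _ _).trans (Finset.sum_le_sum fun j _ => ?_)
  by_cases hj : h < ‖(pt j).1 - x.1‖
  · simp [hw.vanish j x hj]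
  · rw [abs_mul]
    gcongr
    refine (abs_sub_sum_taylorTerm_le hα hL hf x (pt j)).trans ?_
    gcongr
    exact not_lt.1 hj

end Weights

/-! ### Chaining along dyadic grids -/

section HolderNorm

variable {d : ℕ}

lemma norm_sub_le_one (x y : cube d) : ‖x.1 - y.1‖ ≤ 1 := by
  refine (pi_norm_le_iff_of_nonneg zero_le_one).2 fun k => ?_
  rw [Pi.sub_apply, Real.norm_eq_abs]
  exact (abs_sub_le_of_le_of_le (x.2.1 k) (x.2.2 k) (y.2.1 k) (y.2.2 k)).trans_eq (by simp)

/-- The Hölder norm of index `β` of the restriction of `z` to a finite set `S` of points of the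
cube. It is a measurable function of the values of `z`, unlike the Hölder norm on the whole cube. -/
noncomputable def holderNormOn (S : Finset (cube d)) (β : ℝ) (z : cube d → ℝ) : ℝ :=
  max ‖fun u : S => z u‖
    ‖fun q : S × S => (z q.1 - z q.2) / ‖(q.1 : cube d).1 - (q.2 : cube d).1‖ ^ β‖

variable {S : Finset (cube d)} {β b : ℝ} {z : cube d → ℝ} {u v : cube d}

lemma measurable_holderNormOn (S : Finset (cube d)) (β : ℝ) : Measurable (holderNormOn S β) := by
  unfold holderNormOn
  fun_prop

lemma holderNormOn_nonneg (S : Finset (cube d)) (β : ℝ) (z : cube d → ℝ) :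
    0 ≤ holderNormOn S β z :=
  le_max_of_le_left (norm_nonneg _)

lemma abs_le_holderNormOn (hu : u ∈ S) : |z u| ≤ holderNormOn S β z :=
  le_max_of_le_left (norm_le_pi_norm (fun u : S => z u) ⟨u, hu⟩)

lemma abs_sub_le_holderNormOn (hu : u ∈ S) (hv : v ∈ S) :
    |z u - z v| ≤ holderNormOn S β z * ‖u.1 - v.1‖ ^ β := by
  rcases eq_or_ne u v with rfl | huv
  · rw [sub_self, abs_zero]
    exact mul_nonneg (holderNormOn_nonneg _ _ _) (by positivity)
  · have hpos : 0 < ‖u.1 - v.1‖ ^ β :=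
      Real.rpow_pos_of_pos (norm_pos_iff.2 (sub_ne_zero.2 (Subtype.coe_injective.ne huv))) _
    have hquot := norm_le_pi_norm (fun q : S × S =>
      (z q.1 - z q.2) / ‖(q.1 : cube d).1 - (q.2 : cube d).1‖ ^ β) (⟨u, hu⟩, ⟨v, hv⟩)
    rw [norm_div, Real.norm_of_nonneg hpos.le, Real.norm_eq_abs] at hquot
    exact (div_le_iff₀ hpos).1 (hquot.trans (le_max_right _ _))

lemma holderNormOn_le (hb : 0 ≤ b) (hz : ∀ u ∈ S, |z u| ≤ b)
    (hzz : ∀ u ∈ S, ∀ v ∈ S, |z u - z v| ≤ b * ‖u.1 - v.1‖ ^ β) : holderNormOn S β z ≤ b := by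
  refine max_le ((pi_norm_le_iff_of_nonneg hb).2 fun u => hz u u.2)
    ((pi_norm_le_iff_of_nonneg hb).2 fun q => ?_)
  rw [norm_div, Real.norm_of_nonneg (r := _ ^ β) (by positivity)]
  exact div_le_of_le_mul₀ (by positivity) hb (hzz _ q.1.2 _ q.2.2)

end HolderNorm

section Grid

variable {d : ℕ}

/-- The point `q / m` of the regular grid of mesh `1 / m` in the cube. -/
noncomputable def gridPt (m : ℕ) (q : Fin d → Fin (m + 1)) : cube d :=
  ⟨fun k => ((q k : ℕ) : ℝ) / m, fun _ => by simp only [Pi.zero_apply]; positivity, fun k =>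
    div_le_one_of_le₀ (Nat.cast_le.2 (Nat.lt_succ_iff.1 (q k).2)) (Nat.cast_nonneg m)⟩

/-- The index of the point obtained by rounding all coordinates down to the grid of
mesh `1 / m`. -/
noncomputable def gridIdx (m : ℕ) (x : cube d) (k : Fin d) : Fin (m + 1) :=
  ⟨⌊m * x.1 k⌋₊, Nat.lt_succ_iff.2 <| Nat.floor_le_of_le <|
    mul_le_of_le_one_right (Nat.cast_nonneg m) (x.2.2 k)⟩

lemma norm_sub_gridPt_le {m : ℕ} (hm : 0 < m) (x : cube d) :
    ‖x.1 - (gridPt m (gridIdx m x)).1‖ ≤ (m : ℝ)⁻¹ := by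
  have hm' : (0 : ℝ) < m := Nat.cast_pos.2 hm
  refine (pi_norm_le_iff_of_nonneg (by positivity)).2 fun k => ?_
  have hfloor := Nat.floor_le (mul_nonneg hm'.le (x.2.1 k))
  have hlt := Nat.lt_floor_add_one (m * x.1 k)
  have hcoord : (x.1 - (gridPt m (gridIdx m x)).1) k = (m * x.1 k - ⌊m * x.1 k⌋₊) * (m : ℝ)⁻¹ := by
    simp only [gridPt, gridIdx, Pi.sub_apply]
    field_simp
  rw [hcoord, Real.norm_of_nonneg (mul_nonneg (by linarith) (by positivity))]
  exact mul_le_of_le_one_left (by positivity) (by linarith)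

/-- The index of the point obtained by rounding a point of the dyadic grid of mesh `2⁻⁽ᵏ⁺¹⁾` down
to the next coarser one. -/
def parentIdx {k : ℕ} (q : Fin d → Fin (2 ^ (k + 1) + 1)) (l : Fin d) : Fin (2 ^ k + 1) :=
  ⟨(q l : ℕ) / 2, by have := (q l).2; have := pow_succ 2 k; omega⟩

lemma parentIdx_gridIdx (k : ℕ) (x : cube d) :
    parentIdx (gridIdx (2 ^ (k + 1)) x) = gridIdx (2 ^ k) x := by
  funext l
  apply Fin.ext
  simp only [parentIdx, gridIdx]
  rw [← Nat.floor_div_natCast]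
  congr 1
  push_cast
  ring

lemma norm_gridPt_sub_gridPt_parentIdx_le (k : ℕ) (q : Fin d → Fin (2 ^ (k + 1) + 1)) :
    ‖(gridPt (2 ^ (k + 1)) q).1 - (gridPt (2 ^ k) (parentIdx q)).1‖ ≤ ((2 : ℝ) ^ (k + 1))⁻¹ := by
  refine (pi_norm_le_iff_of_nonneg (by positivity)).2 fun l => ?_
  have hcoord : ((gridPt (2 ^ (k + 1)) q).1 - (gridPt (2 ^ k) (parentIdx q)).1) l =
      ((q l % 2 : ℕ) : ℝ) * ((2 : ℝ) ^ (k + 1))⁻¹ := by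
    have hmod : ((q l : ℕ) : ℝ) = (q l % 2 : ℕ) + 2 * ((q l / 2 : ℕ) : ℝ) := by
      exact_mod_cast (Nat.mod_add_div (q l) 2).symm
    simp only [gridPt, parentIdx, Pi.sub_apply]
    rw [hmod]
    push_cast
    field_simp
    ring
  have hmod_le : ((q l % 2 : ℕ) : ℝ) ≤ 1 := by
    exact_mod_cast Nat.lt_succ_iff.1 (Nat.mod_lt _ two_pos)
  rw [hcoord, Real.norm_of_nonneg (by positivity)]
  exact mul_le_of_le_one_left (by positivity) hmod_le

end Grid

section Chaining

variable {d : ℕ}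

/-- The contribution of the dyadic grid of mesh `2⁻ᵏ` to the chaining bound: its mesh to the power
`β` times the constant of the maximal inequality for its `(2ᵏ + 1)ᵈ` points. -/
noncomputable def chainTerm (d : ℕ) (β : ℝ) (k : ℕ) : ℝ :=
  ((2 : ℝ) ^ k)⁻¹ ^ β * √(2 * Real.log (2 * ((2 : ℝ) ^ k + 1) ^ d))

lemma chainTerm_nonneg (d : ℕ) (β : ℝ) (k : ℕ) : 0 ≤ chainTerm d β k := by
  unfold chainTerm; positivity

lemma inv_two_pow_rpow (β : ℝ) (k : ℕ) : ((2 : ℝ) ^ k)⁻¹ ^ β = ((2 : ℝ)⁻¹ ^ β) ^ k := by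
  rw [← inv_pow, Real.rpow_pow_comm (by norm_num)]

lemma inv_two_rpow_lt_one {β : ℝ} (hβ : 0 < β) : (2 : ℝ)⁻¹ ^ β < 1 :=
  Real.rpow_lt_one (by norm_num) (by norm_num) hβ

lemma log_two_mul_two_pow_add_one_pow_le (d k : ℕ) :
    Real.log (2 * ((2 : ℝ) ^ k + 1) ^ d) ≤ ((d : ℝ) + 1) * (k + 1) := by
  have hone : (1 : ℝ) ≤ 2 ^ k := one_le_pow₀ one_le_two
  have hpow : 2 * ((2 : ℝ) ^ k + 1) ^ d ≤ 2 ^ ((d + 1) * (k + 1)) := by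
    calc 2 * ((2 : ℝ) ^ k + 1) ^ d ≤ 2 ^ (k + 1) * (2 ^ (k + 1)) ^ d := by
          gcongr <;> rw [pow_succ] <;> linarith
      _ = 2 ^ ((d + 1) * (k + 1)) := by rw [← pow_mul, ← pow_add]; ring_nf
  calc Real.log (2 * ((2 : ℝ) ^ k + 1) ^ d) ≤ Real.log ((2 : ℝ) ^ ((d + 1) * (k + 1))) :=
        Real.log_le_log (by positivity) hpow
    _ = ((d : ℝ) + 1) * (k + 1) * Real.log 2 := by rw [Real.log_pow]; push_cast; ring
    _ ≤ ((d : ℝ) + 1) * (k + 1) :=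
        mul_le_of_le_one_right (by positivity) (by linarith [Real.log_two_lt_d9])

lemma summable_chainTerm (d : ℕ) {β : ℝ} (hβ : 0 < β) : Summable (chainTerm d β) := by
  set r : ℝ := (2 : ℝ)⁻¹ ^ β
  have hr0 : 0 ≤ r := by positivity
  have hr1 : r < 1 := inv_two_rpow_lt_one hβ
  have hgeom : Summable fun k : ℕ => (2 * ((d : ℝ) + 1)) * ((k : ℝ) ^ 1 * r ^ k + r ^ k) :=
    ((summable_pow_mul_geometric_of_norm_lt_one 1 (by rwa [Real.norm_of_nonneg hr0])).add
      (summable_geometric_of_lt_one hr0 hr1)).mul_left _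
  refine Summable.of_nonneg_of_le (chainTerm_nonneg d β) (fun k => ?_) hgeom
  have hsqrt : √(2 * Real.log (2 * ((2 : ℝ) ^ k + 1) ^ d)) ≤ 2 * (((d : ℝ) + 1) * (k + 1)) := by
    have hone : 1 ≤ ((d : ℝ) + 1) * (k + 1) := one_le_mul_of_one_le_of_one_le (by simp) (by simp)
    refine Real.sqrt_le_iff.2 ⟨by positivity, ?_⟩
    nlinarith [log_two_mul_two_pow_add_one_pow_le d k]
  calc chainTerm d β k ≤ r ^ k * (2 * (((d : ℝ) + 1) * (k + 1))) := by
        rw [chainTerm, inv_two_pow_rpow]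
        gcongr
    _ = 2 * ((d : ℝ) + 1) * ((k : ℝ) ^ 1 * r ^ k + r ^ k) := by ring

lemma exists_inv_two_pow_rpow_mul_le_one {β : ℝ} (hβ : 0 < β) {a : ℝ} (ha : 0 ≤ a) :
    ∃ K : ℕ, ((2 : ℝ) ^ K)⁻¹ ^ β * a ≤ 1 := by
  obtain ⟨K, hK⟩ := exists_pow_lt_of_lt_one (show (0 : ℝ) < (a + 1)⁻¹ by positivity)
    (inv_two_rpow_lt_one hβ)
  refine ⟨K, ?_⟩
  rw [inv_two_pow_rpow]
  calc ((2 : ℝ)⁻¹ ^ β) ^ K * a ≤ (a + 1)⁻¹ * (a + 1) := by gcongr; linarith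
    _ = 1 := inv_mul_cancel₀ (by positivity)

/-- The finite set of points that occurs in the chains through the dyadic grids of mesh at least
`2⁻ᴷ` that end in the points `pts j`. -/
noncomputable def chainSet {J : Type*} [Fintype J] (pts : J → cube d) (K : ℕ) : Finset (cube d) :=
  open Classical in
  Finset.univ.image pts ∪
    (Finset.range (K + 1)).biUnion fun k => Finset.univ.image (gridPt (2 ^ k))

/-- The increment of `z` along the link of a chain that joins a point of the dyadic grid of mesh
`2⁻ᵏ` to its parent; chains start at level `0`, where the increment is the value of `z`. -/
noncomputable def chainIncr (z : cube d → ℝ) : (k : ℕ) → (Fin d → Fin (2 ^ k + 1)) → ℝ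
  | 0, q => z (gridPt (2 ^ 0) q)
  | k + 1, q => z (gridPt (2 ^ (k + 1)) q) - z (gridPt (2 ^ k) (parentIdx q))

lemma sum_chainIncr (z : cube d → ℝ) (K : ℕ) (x : cube d) :
    ∑ k ∈ Finset.range (K + 1), chainIncr z k (gridIdx (2 ^ k) x) =
      z (gridPt (2 ^ K) (gridIdx (2 ^ K) x)) := by
  induction K with
  | zero => simp [chainIncr]
  | succ K ih => rw [Finset.sum_range_succ, ih, chainIncr, parentIdx_gridIdx, add_sub_cancel]

variable {J : Type*} [Fintype J] {pts : J → cube d} {K : ℕ}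

lemma mem_chainSet (j : J) : pts j ∈ chainSet pts K := by simp [chainSet]

lemma gridPt_mem_chainSet {k : ℕ} (hk : k ≤ K) (q : Fin d → Fin (2 ^ k + 1)) :
    gridPt (2 ^ k) q ∈ chainSet pts K := by
  classical
  simp only [chainSet, Finset.mem_union, Finset.mem_biUnion]
  exact Or.inr ⟨k, Finset.mem_range_succ_iff.2 hk, Finset.mem_image_of_mem _ (Finset.mem_univ q)⟩

lemma abs_chainIncr_le {β : ℝ} (hβ : 0 ≤ β) (z : cube d → ℝ) {k : ℕ} (hk : k ≤ K)
    (q : Fin d → Fin (2 ^ k + 1)) :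
    |chainIncr z k q| ≤ ((2 : ℝ) ^ k)⁻¹ ^ β * holderNormOn (chainSet pts K) β z := by
  cases k with
  | zero => simpa [chainIncr] using abs_le_holderNormOn (gridPt_mem_chainSet hk q)
  | succ k =>
    rw [mul_comm]
    refine (abs_sub_le_holderNormOn (S := chainSet pts K) (β := β) (gridPt_mem_chainSet hk q)
      (gridPt_mem_chainSet (Nat.le_of_succ_le hk) (parentIdx q))).trans ?_
    gcongr
    · exact holderNormOn_nonneg _ _ _
    · exact norm_gridPt_sub_gridPt_parentIdx_le k q

variable {ι : Type*} [Fintype ι] {β : ℝ} (z : ι → cube d → ℝ)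

lemma abs_sum_units_smul_sub_gridPt_le (hβ : 0 ≤ β)
    (hK : ((2 : ℝ) ^ K)⁻¹ ^ β * √(Fintype.card ι) ≤ 1) (e : ι → ℤˣ) (j : J) :
    |∑ i, e i • (z i (pts j) - z i (gridPt (2 ^ K) (gridIdx (2 ^ K) (pts j))))| ≤
      √(∑ i, holderNormOn (chainSet pts K) β (z i) ^ 2) := by
  set b : ι → ℝ := fun i => holderNormOn (chainSet pts K) β (z i)
  have hlink : ∀ i, |e i • (z i (pts j) - z i (gridPt (2 ^ K) (gridIdx (2 ^ K) (pts j))))| ≤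
      ((2 : ℝ) ^ K)⁻¹ ^ β * b i := fun i => by
    have habs : ∀ (s : ℤˣ) (a : ℝ), |s • a| = |a| := fun s a => by
      rcases Int.units_eq_one_or s with rfl | rfl <;> simp [Units.neg_smul]
    rw [habs, mul_comm]
    refine (abs_sub_le_holderNormOn (β := β) (mem_chainSet j)
      (gridPt_mem_chainSet le_rfl _)).trans ?_
    gcongr
    · exact holderNormOn_nonneg _ _ _
    · simpa using norm_sub_gridPt_le (m := 2 ^ K) (by positivity) (pts j)
  have hcauchy : ∑ i, b i ≤ √(Fintype.card ι) * √(∑ i, b i ^ 2) := by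
    rw [← Real.sqrt_mul (Nat.cast_nonneg _)]
    exact Real.le_sqrt_of_sq_le (sq_sum_le_card_mul_sum_sq (s := Finset.univ) (f := b))
  calc _ ≤ ∑ i, ((2 : ℝ) ^ K)⁻¹ ^ β * b i :=
        (Finset.abs_sum_le_sum_abs _ _).trans (Finset.sum_le_sum fun i _ => hlink i)
    _ ≤ ((2 : ℝ) ^ K)⁻¹ ^ β * (√(Fintype.card ι) * √(∑ i, b i ^ 2)) := by
        rw [← Finset.mul_sum]
        gcongr
    _ ≤ √(∑ i, b i ^ 2) := by
        rw [← mul_assoc]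
        exact mul_le_of_le_one_left (by positivity) hK

lemma pi_norm_sum_units_smul_le_sum_chainIncr_add (hβ : 0 ≤ β)
    (hK : ((2 : ℝ) ^ K)⁻¹ ^ β * √(Fintype.card ι) ≤ 1) (e : ι → ℤˣ) :
    ‖fun j => ∑ i, e i • z i (pts j)‖ ≤
      ∑ k ∈ Finset.range (K + 1), ‖fun q => ∑ i, e i • chainIncr (z i) k q‖ +
        √(∑ i, holderNormOn (chainSet pts K) β (z i) ^ 2) := by
  refine (pi_norm_le_iff_of_nonneg (by positivity)).2 fun j => ?_
  have htel : ∑ i, e i • z i (pts j) =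
      ∑ k ∈ Finset.range (K + 1), ∑ i, e i • chainIncr (z i) k (gridIdx (2 ^ k) (pts j)) +
        ∑ i, e i • (z i (pts j) - z i (gridPt (2 ^ K) (gridIdx (2 ^ K) (pts j)))) := by
    simp only [Finset.sum_comm (s := Finset.range (K + 1)), ← Finset.smul_sum, sum_chainIncr,
      ← Finset.sum_add_distrib, ← smul_add, add_sub_cancel]
  rw [htel]
  refine (norm_add_le _ _).trans (add_le_add ((norm_sum_le _ _).trans ?_)
    (abs_sum_units_smul_sub_gridPt_le z hβ hK e j))
  exact Finset.sum_le_sum fun k _ => norm_le_pi_norm (fun q => ∑ i, e i • chainIncr (z i) k q) _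

variable [DecidableEq ι]

lemma expect_pi_norm_sum_units_smul_chainIncr_le (hβ : 0 ≤ β) {k : ℕ} (hk : k ≤ K) :
    𝔼 e : ι → ℤˣ, ‖fun q => ∑ i, e i • chainIncr (z i) k q‖ ≤
      chainTerm d β k * √(∑ i, holderNormOn (chainSet pts K) β (z i) ^ 2) := by
  have hsq : ∀ q, ∑ i, chainIncr (z i) k q ^ 2 ≤
      (((2 : ℝ) ^ k)⁻¹ ^ β * √(∑ i, holderNormOn (chainSet pts K) β (z i) ^ 2)) ^ 2 := fun q => by
    rw [mul_pow, Real.sq_sqrt (by positivity), Finset.mul_sum]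
    refine Finset.sum_le_sum fun i _ => ?_
    rw [← mul_pow, ← sq_abs]
    gcongr
    exact abs_chainIncr_le hβ (z i) hk q
  refine (expect_pi_norm_sum_units_smul_le (by positivity) hsq).trans_eq ?_
  simp only [chainTerm, Fintype.card_pi, Fintype.card_fin, Finset.prod_const, Finset.card_univ,
    Nat.cast_pow, Nat.cast_add, Nat.cast_one, Nat.cast_ofNat]
  ring

theorem expect_pi_norm_sum_units_smul_le_chaining (hβ : 0 < β)
    (hK : ((2 : ℝ) ^ K)⁻¹ ^ β * √(Fintype.card ι) ≤ 1) :
    𝔼 e : ι → ℤˣ, ‖fun j => ∑ i, e i • z i (pts j)‖ ≤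
      (∑' k, chainTerm d β k + 1) * √(∑ i, holderNormOn (chainSet pts K) β (z i) ^ 2) := by
  set B := √(∑ i, holderNormOn (chainSet pts K) β (z i) ^ 2)
  calc 𝔼 e : ι → ℤˣ, ‖fun j => ∑ i, e i • z i (pts j)‖
      ≤ 𝔼 e : ι → ℤˣ,
        (∑ k ∈ Finset.range (K + 1), ‖fun q => ∑ i, e i • chainIncr (z i) k q‖ + B) :=
        Finset.expect_le_expect fun e _ =>
          pi_norm_sum_units_smul_le_sum_chainIncr_add z hβ.le hK e
    _ = ∑ k ∈ Finset.range (K + 1), 𝔼 e : ι → ℤˣ,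
          ‖fun q => ∑ i, e i • chainIncr (z i) k q‖ + B := by
        rw [Finset.expect_add_distrib, Finset.expect_sum_comm,
          Finset.expect_const Finset.univ_nonempty]
    _ ≤ ∑ k ∈ Finset.range (K + 1), chainTerm d β k * B + B := by
        gcongr with k hk
        exact expect_pi_norm_sum_units_smul_chainIncr_le z hβ.le (Finset.mem_range_succ_iff.1 hk)
    _ ≤ (∑' k, chainTerm d β k + 1) * B := by
        rw [← Finset.sum_mul, ← add_one_mul]
        gcongr
        exact (summable_chainTerm d hβ).sum_le_tsum _ fun k _ => chainTerm_nonneg d β k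

end Chaining

/-! ### Independent random fields -/

section Fields

lemma integrable_sqrt {Ω : Type*} [MeasurableSpace Ω] {P : Measure Ω} [IsFiniteMeasure P]
    {f : Ω → ℝ} (hf : Integrable f P) : Integrable (fun ω => √(f ω)) P := by
  refine (hf.norm.add (integrable_const 1)).mono'
    hf.aestronglyMeasurable.aemeasurable.sqrt.aestronglyMeasurable (.of_forall fun ω => ?_)
  rw [Real.norm_of_nonneg (Real.sqrt_nonneg _), Pi.add_apply, Real.norm_eq_abs]
  refine Real.sqrt_le_iff.2 ⟨by positivity, ?_⟩
  nlinarith [le_abs_self (f ω), abs_nonneg (f ω)]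

lemma integral_sqrt_le_sqrt_integral {Ω : Type*} [MeasurableSpace Ω] {P : Measure Ω}
    [IsProbabilityMeasure P] {f : Ω → ℝ} (hf : Integrable f P) (hf0 : ∀ ω, 0 ≤ f ω) :
    ∫ ω, √(f ω) ∂P ≤ √(∫ ω, f ω ∂P) :=
  Real.strictConcaveOn_sqrt.concaveOn.le_map_integral Real.continuous_sqrt.continuousOn isClosed_Ici
    (.of_forall hf0) hf (integrable_sqrt hf)

variable {d : ℕ} {ι Ω Ω' : Type*} [MeasurableSpace Ω] [MeasurableSpace Ω'] {P : Measure Ω}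
  {P' : Measure Ω'}

/-- Independent centered random fields on the cube whose Hölder norms of index `β` are bounded by
`v` in mean square. Only the Hölder norms on finite sets are required to be so bounded, because the
chaining bound for finitely many design points involves no others. -/
structure IndepHolderFields (P : Measure Ω) (β v : ℝ) (Z : ι → Ω → cube d → ℝ) : Prop where
  measurable : ∀ i x, Measurable fun ω => Z i ω x
  indep : iIndepFun Z P
  centered : ∀ i x, ∫ ω, Z i ω x ∂P = 0
  memLp_holderNormOn : ∀ i S, MemLp (fun ω => holderNormOn S β (Z i ω)) 2 P
  integral_sq_holderNormOn_le : ∀ i S, ∫ ω, holderNormOn S β (Z i ω) ^ 2 ∂P ≤ v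

namespace IndepHolderFields

variable {β v : ℝ} {Z : ι → Ω → cube d → ℝ} (hZ : IndepHolderFields P β v Z)
include hZ

lemma integrable [IsFiniteMeasure P] (i : ι) (x : cube d) : Integrable (fun ω => Z i ω x) P :=
  ((hZ.memLp_holderNormOn i {x}).integrable one_le_two).mono'
    (hZ.measurable i x).aestronglyMeasurable
    (.of_forall fun _ => abs_le_holderNormOn (Finset.mem_singleton_self x))

variable [Fintype ι] {J : Type*} [Fintype J]

lemma integral_sqrt_sum_sq_holderNormOn_le [IsProbabilityMeasure P] (S : Finset (cube d)) :
    ∫ ω, √(∑ i, holderNormOn S β (Z i ω) ^ 2) ∂P ≤ √(Fintype.card ι * v) := by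
  have hint : ∀ i ∈ Finset.univ, Integrable (fun ω => holderNormOn S β (Z i ω) ^ 2) P :=
    fun i _ => (hZ.memLp_holderNormOn i S).integrable_sq
  refine (integral_sqrt_le_sqrt_integral (integrable_finsetSum _ hint)
    fun ω => by positivity).trans (Real.sqrt_le_sqrt ?_)
  rw [integral_finsetSum _ hint]
  exact (Finset.sum_le_sum fun i _ => hZ.integral_sq_holderNormOn_le i S).trans_eq (by simp)

theorem integral_pi_norm_sum_le [IsProbabilityMeasure P] (hβ : 0 < β) (pts : J → cube d) :
    ∫ ω, ‖fun j => ∑ i, Z i ω (pts j)‖ ∂P ≤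
      2 * ((∑' k, chainTerm d β k + 1) * √(Fintype.card ι * v)) := by
  classical
  obtain ⟨K, hK⟩ := exists_inv_two_pow_rpow_mul_le_one hβ (Real.sqrt_nonneg (Fintype.card ι))
  set X : ι → Ω → J → ℝ := fun i ω j => Z i ω (pts j)
  have hX : ∀ i, Integrable (X i) P := fun i => Integrable.of_eval fun j => hZ.integrable i (pts j)
  have hcentered : ∀ i, ∫ ω, X i ω ∂P = 0 := fun i => by
    funext j
    rw [eval_integral fun j => hZ.integrable i (pts j), Pi.zero_apply, hZ.centered]
  have hindep : iIndepFun X P :=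
    hZ.indep.comp (fun _ z j => z (pts j)) fun _ => by fun_prop
  have hbound := integrable_sqrt (integrable_finsetSum Finset.univ
    fun i _ => (hZ.memLp_holderNormOn i (chainSet pts K)).integrable_sq)
  have hsymm := integral_norm_sum_le_two_mul_integral_of_expect_le hindep
    (fun i => measurable_pi_lambda _ fun j => hZ.measurable i (pts j)) hX hcentered
    (hbound.const_mul (∑' k, chainTerm d β k + 1)) fun ω => by
      refine le_trans (le_of_eq ?_)
        (expect_pi_norm_sum_units_smul_le_chaining (pts := pts) (fun i => Z i ω) hβ hK)
      congr! with e _ j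
      simp [X]
  have hC : 0 ≤ ∑' k, chainTerm d β k + 1 :=
    add_nonneg (tsum_nonneg (chainTerm_nonneg d β)) zero_le_one
  calc ∫ ω, ‖fun j => ∑ i, Z i ω (pts j)‖ ∂P = ∫ ω, ‖∑ i, X i ω‖ ∂P := by
        congr! with ω j
        simp [X]
    _ ≤ 2 * ((∑' k, chainTerm d β k + 1) *
          ∫ ω, √(∑ i, holderNormOn (chainSet pts K) β (Z i ω) ^ 2) ∂P) := by
        rwa [integral_const_mul] at hsymm
    _ ≤ 2 * ((∑' k, chainTerm d β k + 1) * √(Fintype.card ι * v)) := by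
        gcongr
        exact hZ.integral_sqrt_sum_sq_holderNormOn_le _

end IndepHolderFields

lemma InProcessClass.exists_holderNormOn_ae_le {β₀ CZ : ℝ} (hβ₀ : 0 < β₀) {Z : Ω' → cube d → ℝ}
    (hZ : InProcessClass P' β₀ CZ Z) (S : Finset (cube d)) :
    ∃ M : Ω' → ℝ, MemLp M 2 P' ∧ MemLp (fun ω => Z ω (origin d)) 2 P' ∧
      ∫ ω, M ω ^ 2 ∂P' + ∫ ω, Z ω (origin d) ^ 2 ∂P' ≤ CZ ∧
      ∀ᵐ ω ∂P', holderNormOn S β₀ (Z ω) ≤ |Z ω (origin d)| + M ω := by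
  obtain ⟨-, β, hβ, M, -, hMpos, hM, hZ0, hle, hHolder⟩ := hZ
  refine ⟨M, hM, hZ0, hle, ?_⟩
  have hexp : ∀ u v : cube d, ‖u.1 - v.1‖ ^ β ≤ ‖u.1 - v.1‖ ^ β₀ := fun u v => by
    rcases (norm_nonneg (u.1 - v.1)).eq_or_lt' with h0 | h0
    · rw [h0, Real.zero_rpow (hβ₀.trans_le hβ.1).ne', Real.zero_rpow hβ₀.ne']
    · exact Real.rpow_le_rpow_of_exponent_ge h0 (norm_sub_le_one u v) hβ.1
  filter_upwards [hMpos, ae_all_iff.2 fun u : S => hHolder u (origin d),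
    ae_all_iff.2 fun q : S × S => hHolder q.1 q.2] with ω hMω h0 hSω
  refine holderNormOn_le (by positivity) (fun u hu => ?_) fun u hu v hv => ?_
  · have hincr : |Z ω u - Z ω (origin d)| ≤ M ω := (h0 ⟨u, hu⟩).trans <|
      mul_le_of_le_one_right hMω.le <|
        Real.rpow_le_one (norm_nonneg _) (norm_sub_le_one _ _) (hβ₀.le.trans hβ.1)
    linarith [abs_sub_abs_le_abs_sub (Z ω u) (Z ω (origin d))]
  · refine (hSω (⟨u, hu⟩, ⟨v, hv⟩)).trans ?_
    exact mul_le_mul (le_add_of_nonneg_left (abs_nonneg _)) (hexp u v) (by positivity)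
      (by positivity)

lemma InProcessClass.memLp_holderNormOn {β₀ CZ : ℝ} (hβ₀ : 0 < β₀) {Z : Ω' → cube d → ℝ}
    (hZ : InProcessClass P' β₀ CZ Z) (S : Finset (cube d)) :
    MemLp (fun ω => holderNormOn S β₀ (Z ω)) 2 P' := by
  obtain ⟨M, hM, hZ0, -, hle⟩ := hZ.exists_holderNormOn_ae_le hβ₀ S
  refine (hZ0.abs.add hM).mono ((measurable_holderNormOn S β₀).comp
    (measurable_pi_lambda _ hZ.1)).aestronglyMeasurable ?_
  filter_upwards [hle] with ω hω
  rw [Real.norm_of_nonneg (holderNormOn_nonneg _ _ _)]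
  exact hω.trans (le_abs_self _)

lemma InProcessClass.integral_sq_holderNormOn_le {β₀ CZ : ℝ} (hβ₀ : 0 < β₀) {Z : Ω' → cube d → ℝ}
    (hZ : InProcessClass P' β₀ CZ Z) (S : Finset (cube d)) :
    ∫ ω, holderNormOn S β₀ (Z ω) ^ 2 ∂P' ≤ 2 * CZ := by
  obtain ⟨M, hM, hZ0, hCZ, hle⟩ := hZ.exists_holderNormOn_ae_le hβ₀ S
  calc ∫ ω, holderNormOn S β₀ (Z ω) ^ 2 ∂P'
      ≤ ∫ ω, 2 * (M ω ^ 2 + Z ω (origin d) ^ 2) ∂P' := by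
        refine integral_mono_ae (hZ.memLp_holderNormOn hβ₀ S).integrable_sq
          ((hM.integrable_sq.add hZ0.integrable_sq).const_mul 2) ?_
        filter_upwards [hle] with ω hω
        calc holderNormOn S β₀ (Z ω) ^ 2 ≤ (|Z ω (origin d)| + M ω) ^ 2 :=
              pow_le_pow_left₀ (holderNormOn_nonneg _ _ _) hω 2
          _ ≤ 2 * (|Z ω (origin d)| ^ 2 + M ω ^ 2) := add_sq_le
          _ = 2 * (M ω ^ 2 + Z ω (origin d) ^ 2) := by rw [sq_abs, add_comm]
    _ = 2 * (∫ ω, M ω ^ 2 ∂P' + ∫ ω, Z ω (origin d) ^ 2 ∂P') := by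
        rw [integral_const_mul, integral_add hM.integrable_sq hZ0.integrable_sq]
    _ ≤ 2 * CZ := by gcongr

lemma ModelAssumptions.indepHolderFields {n : ℕ} {p : Fin d → ℕ} {β₀ CZ ζ σ : ℝ} (hβ₀ : 0 < β₀)
    {Z : Ω' → cube d → ℝ} {Zs : Fin n → Ω → cube d → ℝ} {ε : Fin n → Idx p → Ω → ℝ}
    (hM : ModelAssumptions P P' ζ σ Z Zs ε) (hZ : InProcessClass P' β₀ CZ Z) :
    IndepHolderFields P β₀ (2 * CZ) Zs where
  measurable := hM.measurable_field
  indep := hM.indep_field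
  centered i x := ((hM.identDistrib_field i).comp (measurable_pi_apply x)).integral_eq.trans
    (hM.centered_field x)
  memLp_holderNormOn i S := ((hM.identDistrib_field i).comp
    (measurable_holderNormOn S β₀)).memLp_iff.2 (hZ.memLp_holderNormOn hβ₀ S)
  integral_sq_holderNormOn_le i S := ((hM.identDistrib_field i).comp
    ((measurable_holderNormOn S β₀).pow_const 2)).integral_eq.trans_le
      (hZ.integral_sq_holderNormOn_le hβ₀ S)

end Fields

/-! ### Averaged errors -/

section Errors

variable {Ω : Type*} [MeasurableSpace Ω] {P : Measure Ω} {d : ℕ} {J : Type*} [Fintype J]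
  {η : J → Ω → ℝ} {s : ℝ}

/-- The random vector `η` is sub-Gaussian with parameter `s`: the variance proxy of each linear
combination of its coordinates is `s²` times the squared Euclidean norm of the coefficients. -/
def IsSubgaussianVector (η : J → Ω → ℝ) (s : ℝ) (P : Measure Ω) : Prop :=
  ∀ a : J → ℝ,
    HasSubgaussianMGF (fun ω => ∑ j, a j * η j ω) (s ^ 2 * ∑ j, a j ^ 2).toNNReal P

namespace IsSubgaussianVector

lemma average {n : ℕ} {τ : ℝ} {ε : Fin n → J → Ω → ℝ}
    (hind : iIndepFun (fun ij : Fin n × J => ε ij.1 ij.2) P)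
    (hε : ∀ i j, HasSubgaussianMGF (ε i j) (τ ^ 2).toNNReal P) :
    IsSubgaussianVector (fun j ω => 1 / (n : ℝ) * ∑ i, ε i j ω) (τ / √n) P := by
  intro a
  have hterm (ij : Fin n × J) : HasSubgaussianMGF (fun ω => a ij.2 / n * ε ij.1 ij.2 ω)
      ((a ij.2 / n) ^ 2 * τ ^ 2).toNNReal P := by
    rw [Real.toNNReal_mul (sq_nonneg _), Real.toNNReal_of_nonneg (sq_nonneg (a ij.2 / n))]
    exact (hε ij.1 ij.2).const_mul (a ij.2 / n)
  have hsum := HasSubgaussianMGF.sum_of_iIndepFun (s := Finset.univ)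
    (hind.comp (fun ij x => a ij.2 / n * x) fun ij => measurable_const_mul _)
    fun ij _ => hterm ij
  convert hsum using 1
  · funext ω
    simp only [Fintype.sum_prod_type_right, Function.comp_apply, Finset.mul_sum]
    exact Finset.sum_congr rfl fun j _ => Finset.sum_congr rfl fun i _ => by ring
  · rw [← Real.toNNReal_sum_of_nonneg fun _ _ => by positivity, div_pow,
      Real.sq_sqrt n.cast_nonneg, Fintype.sum_prod_type_right, Finset.mul_sum]
    refine congrArg _ (Finset.sum_congr rfl fun j _ => ?_)
    rcases n.eq_zero_or_pos with rfl | hn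
    · simp
    · simp only [Finset.sum_const, Finset.card_univ, Fintype.card_fin, nsmul_eq_mul]
      field_simp

variable (hη : IsSubgaussianVector η s P)
include hη

lemma hasSubgaussianMGF (j : J) : HasSubgaussianMGF (η j) (s ^ 2).toNNReal P := by
  classical
  simpa [Pi.single_apply] using hη (Pi.single j 1)

lemma integrable_sum_mul (a : J → ℝ) : Integrable (fun ω => ∑ j, a j * η j ω) P :=
  (hη a).integrable

lemma integrable_sum_abs : Integrable (fun ω => ∑ j, |η j ω|) P :=
  integrable_finsetSum _ fun j _ => (hη.hasSubgaussianMGF j).integrable.abs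

lemma integral_sum_abs_le [IsProbabilityMeasure P] (hs : 0 ≤ s) :
    ∫ ω, ∑ j, |η j ω| ∂P ≤ Fintype.card J * (s * √(2 * Real.log 2)) := by
  rw [integral_finsetSum _ fun j _ => (hη.hasSubgaussianMGF j).integrable.abs, ← nsmul_eq_mul]
  refine Finset.sum_le_card_nsmul _ _ _ fun j _ => ?_
  simpa using integral_pi_norm_le (ι := Unit) hs fun _ => hη.hasSubgaussianMGF j

end IsSubgaussianVector

lemma log_two_mul_card_grid_le {h : ℝ} (hh : 0 < h) :
    Real.log (2 * Fintype.card (Fin d → Fin (⌈(h ^ (d + 1))⁻¹⌉₊ + 1))) ≤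
      Real.log (2 * 3 ^ d) + d * (d + 1) * Real.posLog h⁻¹ := by
  have hceil : (⌈(h ^ (d + 1))⁻¹⌉₊ : ℝ) + 1 ≤ 3 * max 1 h⁻¹ ^ (d + 1) := by
    have hlt := Nat.ceil_lt_add_one (show 0 ≤ (h ^ (d + 1))⁻¹ by positivity)
    have hle : (h ^ (d + 1))⁻¹ ≤ max 1 h⁻¹ ^ (d + 1) := by
      rw [← inv_pow]
      gcongr
      exact le_max_right _ _
    have hone : 1 ≤ max 1 h⁻¹ ^ (d + 1) := one_le_pow₀ (le_max_left _ _)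
    linarith
  have hmax : Real.log (max 1 h⁻¹) = Real.posLog h⁻¹ :=
    (Real.posLog_eq_log_max_one (by positivity)).symm
  calc Real.log (2 * Fintype.card (Fin d → Fin (⌈(h ^ (d + 1))⁻¹⌉₊ + 1)))
      ≤ Real.log (2 * (3 * max 1 h⁻¹ ^ (d + 1)) ^ d) := by
        simp only [Fintype.card_pi, Fintype.card_fin, Finset.prod_const, Finset.card_univ]
        push_cast
        gcongr
    _ = Real.log (2 * 3 ^ d * max 1 h⁻¹ ^ ((d + 1) * d)) := by
        rw [mul_pow, ← pow_mul, mul_assoc]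
    _ = Real.log (2 * 3 ^ d) + d * (d + 1) * Real.posLog h⁻¹ := by
        rw [Real.log_mul (by positivity) (by positivity), Real.log_pow, hmax]
        push_cast
        ring

/-- The factor by which `max (log⁺ h⁻¹ / (m h ^ d)) 1` bounds `1 / (m h ^ d)` times the
logarithmic size of a grid of mesh `h ^ (d + 1)`. -/
noncomputable def gridConst (d : ℕ) : ℝ :=
  Real.log (2 * 3 ^ d) * (2 ^ d + (Real.log 2)⁻¹) + d * (d + 1)

lemma sqrt_posLog_div_eq_sqrt_log_div {x y : ℝ} (hy : 0 ≤ y) :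
    √(Real.posLog x / y) = √(Real.log x / y) := by
  rw [Real.sqrt_div' _ hy, Real.sqrt_div' _ hy, Real.posLog, Real.sqrt_monotone.map_max,
    Real.sqrt_zero, max_eq_right (Real.sqrt_nonneg _)]

lemma log_two_mul_three_pow_nonneg (d : ℕ) : 0 ≤ Real.log (2 * 3 ^ d) := by
  have : (1 : ℝ) ≤ 3 ^ d := one_le_pow₀ (by norm_num)
  exact Real.log_nonneg (by linarith)

lemma gridConst_nonneg (d : ℕ) : 0 ≤ gridConst d := by
  have := log_two_mul_three_pow_nonneg d
  have := Real.log_pos one_lt_two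
  unfold gridConst
  positivity

lemma inv_mul_pow_le_mul_max {h m : ℝ} (hh : 0 < h) (hm : 1 ≤ m) :
    (m * h ^ d)⁻¹ ≤ (2 ^ d + (Real.log 2)⁻¹) * max (Real.posLog h⁻¹ / (m * h ^ d)) 1 := by
  set r := max (Real.posLog h⁻¹ / (m * h ^ d)) 1
  have hlog2 : 0 < Real.log 2 := Real.log_pos one_lt_two
  have hlogr : Real.posLog h⁻¹ / (m * h ^ d) ≤ r := le_max_left _ _
  have h1r : 1 ≤ r := le_max_right _ _
  rw [add_mul]
  rcases le_or_gt (2⁻¹ : ℝ) h with hge | hlt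
  · have hmh : 2⁻¹ ^ d ≤ m * h ^ d :=
      (pow_le_pow_left₀ (by positivity) hge d).trans (le_mul_of_one_le_left (by positivity) hm)
    calc (m * h ^ d)⁻¹ ≤ 2 ^ d := inv_le_of_inv_le₀ (by positivity) (by rwa [← inv_pow])
      _ ≤ 2 ^ d * r := le_mul_of_one_le_right (by positivity) h1r
      _ ≤ 2 ^ d * r + (Real.log 2)⁻¹ * r := le_add_of_nonneg_right (by positivity)
  · have hlogh : Real.log 2 ≤ Real.posLog h⁻¹ :=
      (Real.log_le_log two_pos (by rw [le_inv_comm₀ two_pos hh]; exact hlt.le)).trans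
        (le_max_right _ _)
    have hle : (m * h ^ d)⁻¹ ≤ (Real.log 2)⁻¹ * r := by
      rw [inv_mul_eq_div, le_div_iff₀ hlog2, inv_mul_eq_div]
      exact (by gcongr : _ ≤ Real.posLog h⁻¹ / (m * h ^ d)).trans hlogr
    exact hle.trans (le_add_of_nonneg_left (by positivity))

lemma log_two_mul_card_grid_div_le {h m : ℝ} (hh : 0 < h) (hm : 1 ≤ m) :
    Real.log (2 * Fintype.card (Fin d → Fin (⌈(h ^ (d + 1))⁻¹⌉₊ + 1))) / (m * h ^ d) ≤
      gridConst d * max (Real.posLog h⁻¹ / (m * h ^ d)) 1 := by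
  have hlogr := le_max_left (Real.posLog h⁻¹ / (m * h ^ d)) 1
  have hinv := inv_mul_pow_le_mul_max hh hm (d := d)
  set r := max (Real.posLog h⁻¹ / (m * h ^ d)) 1
  calc Real.log (2 * Fintype.card (Fin d → Fin (⌈(h ^ (d + 1))⁻¹⌉₊ + 1))) / (m * h ^ d)
      ≤ (Real.log (2 * 3 ^ d) + d * (d + 1) * Real.posLog h⁻¹) / (m * h ^ d) := by
        gcongr
        exact log_two_mul_card_grid_le hh
    _ = Real.log (2 * 3 ^ d) * (m * h ^ d)⁻¹ +
          d * (d + 1) * (Real.posLog h⁻¹ / (m * h ^ d)) := by ring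
    _ ≤ Real.log (2 * 3 ^ d) * ((2 ^ d + (Real.log 2)⁻¹) * r) + d * (d + 1) * r := by
        have := log_two_mul_three_pow_nonneg d
        gcongr
    _ = gridConst d * r := by rw [gridConst]; ring

variable {pt : J → cube d} {γ : ℕ} {C₁ C₂ C₃ m h : ℝ} {w : J → cube d → ℝ}

lemma LocalWeights.abs_sum_mul_le_pi_norm_grid (hw : LocalWeights pt γ C₁ C₂ m h w) (hC₂ : 0 ≤ C₂)
    (hm : 0 < m) (hh : 0 < h) {M : ℕ} (hM : (h ^ (d + 1))⁻¹ ≤ M) (e : J → ℝ) (x : cube d) :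
    |∑ j, w j x * e j| ≤ ‖fun q => ∑ j, w j (gridPt M q) * e j‖ + C₂ / m * ∑ j, |e j| := by
  set g := gridPt M (gridIdx M x)
  have hM0 : (0 : ℝ) < M := lt_of_lt_of_le (by positivity) hM
  have hdist : ‖x.1 - g.1‖ ≤ h ^ (d + 1) :=
    (norm_sub_gridPt_le (Nat.cast_pos.1 hM0) x).trans (inv_le_of_inv_le₀ (by positivity) hM)
  have hincr (j : J) : |w j x - w j g| ≤ C₂ / m :=
    calc |w j x - w j g| ≤ C₂ / (m * h ^ (d + 1)) * ‖x.1 - g.1‖ := hw.abs_sub_le hC₂ hm hh j x g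
      _ ≤ C₂ / (m * h ^ (d + 1)) * h ^ (d + 1) := by gcongr
      _ = C₂ / m := by field_simp
  calc |∑ j, w j x * e j| = |∑ j, w j g * e j + ∑ j, (w j x - w j g) * e j| := by
        rw [← Finset.sum_add_distrib]
        exact congrArg _ (Finset.sum_congr rfl fun j _ => by ring)
    _ ≤ |∑ j, w j g * e j| + |∑ j, (w j x - w j g) * e j| := abs_add_le _ _
    _ ≤ ‖fun q => ∑ j, w j (gridPt M q) * e j‖ + C₂ / m * ∑ j, |e j| := by
        refine add_le_add
          (norm_le_pi_norm (fun q => ∑ j, w j (gridPt M q) * e j) (gridIdx M x)) ?_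
        rw [Finset.mul_sum]
        refine (Finset.abs_sum_le_sum_abs _ _).trans (Finset.sum_le_sum fun j _ => ?_)
        rw [abs_mul]
        gcongr
        exact hincr j

lemma LocalWeights.integral_pi_norm_grid_le [IsProbabilityMeasure P]
    (hw : LocalWeights pt γ C₁ C₂ m h w) (hpt : SparseDesign pt C₃ m h)
    (hη : IsSubgaussianVector η s P) (hs : 0 ≤ s) (hC₃ : 0 ≤ C₃) (hm : 1 ≤ m) (hh : 0 < h) :
    ∫ ω, ‖fun q => ∑ j, w j (gridPt ⌈(h ^ (d + 1))⁻¹⌉₊ q) * η j ω‖ ∂P ≤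
      s * √(2 * C₁ ^ 2 * C₃ * gridConst d) * max (√(Real.log h⁻¹ / (m * h ^ d))) 1 := by
  have hm0 : 0 < m := one_pos.trans_le hm
  set l := Real.log (2 * Fintype.card (Fin d → Fin (⌈(h ^ (d + 1))⁻¹⌉₊ + 1)))
  have hsub (q) : HasSubgaussianMGF (fun ω => ∑ j, w j (gridPt ⌈(h ^ (d + 1))⁻¹⌉₊ q) * η j ω)
      ((s * √(C₁ ^ 2 * C₃ / (m * h ^ d))) ^ 2).toNNReal P := by
    refine hasSubgaussianMGF_mono (hη _) (Real.toNNReal_le_toNNReal ?_)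
    rw [mul_pow, Real.sq_sqrt (by positivity)]
    gcongr
    exact hw.sum_sq_le hpt hm0 hh _
  calc ∫ ω, ‖fun q => ∑ j, w j (gridPt ⌈(h ^ (d + 1))⁻¹⌉₊ q) * η j ω‖ ∂P
      ≤ s * √(C₁ ^ 2 * C₃ / (m * h ^ d)) * √(2 * l) :=
        integral_pi_norm_le (by positivity) hsub
    _ = s * √(2 * C₁ ^ 2 * C₃ * (l / (m * h ^ d))) := by
        rw [mul_assoc, ← Real.sqrt_mul (by positivity)]
        congr 2
        ring
    _ ≤ s * √(2 * C₁ ^ 2 * C₃ * (gridConst d * max (Real.posLog h⁻¹ / (m * h ^ d)) 1)) := by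
        gcongr
        exact log_two_mul_card_grid_div_le hh hm
    _ = s * √(2 * C₁ ^ 2 * C₃ * gridConst d) * max (√(Real.log h⁻¹ / (m * h ^ d))) 1 := by
        have := gridConst_nonneg d
        rw [← mul_assoc (2 * C₁ ^ 2 * C₃), Real.sqrt_mul (by positivity),
          Real.sqrt_monotone.map_max, Real.sqrt_one,
          sqrt_posLog_div_eq_sqrt_log_div (by positivity), mul_assoc s]

/-- The constant in the bound for a locally weighted sub-Gaussian vector. -/
noncomputable def noiseConst (d : ℕ) (C₁ C₂ C₃ : ℝ) : ℝ :=
  √(2 * C₁ ^ 2 * C₃ * gridConst d) + C₂ * √(2 * Real.log 2)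

lemma noiseConst_nonneg (d : ℕ) (C₁ C₃ : ℝ) (hC₂ : 0 ≤ C₂) : 0 ≤ noiseConst d C₁ C₂ C₃ := by
  unfold noiseConst
  positivity

theorem LocalWeights.exists_integral_le_of_isSubgaussianVector [IsProbabilityMeasure P]
    (hw : LocalWeights pt γ C₁ C₂ m h w) (hpt : SparseDesign pt C₃ m h)
    (hη : IsSubgaussianVector η s P) (hs : 0 ≤ s) (hC₂ : 0 ≤ C₂) (hC₃ : 0 ≤ C₃) (hm : 1 ≤ m)
    (hJ : Fintype.card J ≤ m) (hh : 0 < h) :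
    ∃ G : Ω → ℝ, Integrable G P ∧ (∀ ω x, |∑ j, w j x * η j ω| ≤ G ω) ∧
      ∫ ω, G ω ∂P ≤
        noiseConst d C₁ C₂ C₃ * (s * max (√(Real.log h⁻¹ / (m * h ^ d))) 1) := by
  have hm0 : 0 < m := one_pos.trans_le hm
  have hgrid : Integrable
      (fun ω => ‖fun q => ∑ j, w j (gridPt ⌈(h ^ (d + 1))⁻¹⌉₊ q) * η j ω‖) P :=
    integrable_pi_norm fun _ => hη.integrable_sum_mul _
  have hsum := hη.integrable_sum_abs.const_mul (C₂ / m)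
  refine ⟨_, hgrid.add hsum,
    fun ω x => hw.abs_sum_mul_le_pi_norm_grid hC₂ hm0 hh (Nat.le_ceil _) _ x, ?_⟩
  simp only [Pi.add_apply]
  rw [integral_add hgrid hsum, integral_const_mul, noiseConst, add_mul]
  set r := max (√(Real.log h⁻¹ / (m * h ^ d))) 1
  refine add_le_add ((hw.integral_pi_norm_grid_le hpt hη hs hC₃ hm hh).trans_eq (by ring)) ?_
  calc C₂ / m * ∫ ω, ∑ j, |η j ω| ∂P ≤ C₂ / m * (m * (s * √(2 * Real.log 2))) := by
        gcongr
        exact (hη.integral_sum_abs_le hs).trans (by gcongr)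
    _ = C₂ * √(2 * Real.log 2) * (s * 1) := by field_simp
    _ ≤ C₂ * √(2 * Real.log 2) * (s * r) := by
        gcongr
        exact le_max_right _ _

end Errors

/-! ### The bound for a single bandwidth -/

section Bandwidth

variable {d : ℕ} {J : Type*} [Fintype J] {pt : J → cube d} {α L C₁ C₂ C₃ m h : ℝ}
  {f : (Fin d → ℝ) → ℝ} {w : J → cube d → ℝ}

lemma abs_sum_mul_add_add_sub_le (hα : 0 < α) (hL : 0 ≤ L) (hf : f ∈ HolderClass (d := d) α L)
    (hw : LocalWeights pt (strictFloor α) C₁ C₂ m h w) (hpt : SparseDesign pt C₃ m h)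
    (hC₁ : 0 ≤ C₁) (hm : 0 < m) (hh : 0 < h) (z e : J → ℝ) (x : cube d) :
    |∑ j, w j x * (f (pt j) + z j + e j) - f x| ≤
      C₁ * C₃ * (d ^ strictFloor α * L * h ^ α + ‖z‖) + |∑ j, w j x * e j| := by
  have hbias := abs_sum_mul_sub_le_sum_abs_mul hα hL hf hw x
  have hz : |∑ j, w j x * z j| ≤ (∑ j, |w j x|) * ‖z‖ := by
    rw [Finset.sum_mul]
    refine (Finset.abs_sum_le_sum_abs _ _).trans (Finset.sum_le_sum fun j _ => ?_)
    rw [abs_mul]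
    exact mul_le_mul_of_nonneg_left (norm_le_pi_norm z j) (abs_nonneg _)
  calc |∑ j, w j x * (f (pt j) + z j + e j) - f x|
      = |(∑ j, w j x * f (pt j) - f x) + ∑ j, w j x * z j + ∑ j, w j x * e j| := by
        simp only [mul_add, Finset.sum_add_distrib]
        ring_nf
    _ ≤ |∑ j, w j x * f (pt j) - f x| + |∑ j, w j x * z j| + |∑ j, w j x * e j| :=
        abs_add_three _ _ _
    _ ≤ (∑ j, |w j x|) * (d ^ strictFloor α * L * h ^ α + ‖z‖) + |∑ j, w j x * e j| := by
        rw [mul_add]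
        gcongr
    _ ≤ C₁ * C₃ * (d ^ strictFloor α * L * h ^ α + ‖z‖) + |∑ j, w j x * e j| := by
        gcongr
        exact hw.sum_abs_le hpt hC₁ hm hh x

lemma natCast_rpow_neg_half (n : ℕ) : (n : ℝ) ^ (-(1 / 2) : ℝ) = (√n)⁻¹ := by
  rw [Real.rpow_neg n.cast_nonneg, Real.sqrt_eq_rpow]

lemma average_add_add {n : ℕ} (hn : 0 < n) (a : ℝ) (z e : Fin n → ℝ) :
    1 / (n : ℝ) * ∑ i, (a + z i + e i) = a + 1 / (n : ℝ) * ∑ i, z i + 1 / (n : ℝ) * ∑ i, e i := by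
  simp only [Finset.sum_add_distrib, Finset.sum_const, Finset.card_univ, Fintype.card_fin,
    nsmul_eq_mul]
  field_simp

variable {Ω : Type*} [MeasurableSpace Ω] {P : Measure Ω} {n : ℕ} {β v τ : ℝ}
  {Z : Fin n → Ω → cube d → ℝ} {ε : Fin n → J → Ω → ℝ}

lemma IndepHolderFields.integral_pi_norm_average_le [IsProbabilityMeasure P]
    (hZ : IndepHolderFields P β v Z) (hβ : 0 < β) (pts : J → cube d) :
    ∫ ω, ‖fun j => 1 / (n : ℝ) * ∑ i, Z i ω (pts j)‖ ∂P ≤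
      2 * (∑' k, chainTerm d β k + 1) * √v * (n : ℝ) ^ (-(1 / 2) : ℝ) := by
  have hnorm (ω : Ω) : ‖fun j => 1 / (n : ℝ) * ∑ i, Z i ω (pts j)‖ =
      1 / (n : ℝ) * ‖fun j => ∑ i, Z i ω (pts j)‖ := by
    simpa [Pi.smul_def] using norm_smul (1 / (n : ℝ)) fun j => ∑ i, Z i ω (pts j)
  simp only [hnorm]
  rw [integral_const_mul, natCast_rpow_neg_half, one_div, inv_mul_eq_div]
  calc (∫ ω, ‖fun j => ∑ i, Z i ω (pts j)‖ ∂P) / n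
      ≤ 2 * ((∑' k, chainTerm d β k + 1) * √(Fintype.card (Fin n) * v)) / n := by
        gcongr
        exact hZ.integral_pi_norm_sum_le hβ pts
    _ = 2 * (∑' k, chainTerm d β k + 1) * √v * (√n / n) := by
        rw [Fintype.card_fin, Real.sqrt_mul n.cast_nonneg]
        ring
    _ = 2 * (∑' k, chainTerm d β k + 1) * √v * (√n)⁻¹ := by rw [Real.sqrt_div_self']; simp

lemma div_sqrt_mul_max_sqrt_log (τ m h : ℝ) (n : ℕ) :
    τ / √n * max (√(Real.log h⁻¹ / (m * h ^ d))) 1 =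
      τ * max (√(Real.log h⁻¹ / (n * m * h ^ d))) ((n : ℝ) ^ (-(1 / 2) : ℝ)) := by
  rw [natCast_rpow_neg_half, div_eq_mul_inv, mul_assoc,
    mul_max_of_nonneg _ _ (inv_nonneg.2 (Real.sqrt_nonneg _)), mul_one, inv_mul_eq_div,
    ← Real.sqrt_div' _ n.cast_nonneg, div_div]
  ring_nf

lemma lintegral_iSup_enorm_le_ofReal_integral {T : Type*} [Nonempty T] {g : Ω → T → ℝ} {R : Ω → ℝ}
    (hR : Integrable R P) (hg : ∀ ω x, |g ω x| ≤ R ω) :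
    ∫⁻ ω, ⨆ x, ‖g ω x‖ₑ ∂P ≤ ENNReal.ofReal (∫ ω, R ω ∂P) := by
  have hR0 (ω) : 0 ≤ R ω := (abs_nonneg _).trans (hg ω (Classical.arbitrary T))
  rw [ofReal_integral_eq_lintegral_ofReal hR (.of_forall hR0)]
  refine lintegral_mono fun ω => iSup_le fun x => ?_
  rw [← ofReal_norm]
  exact ENNReal.ofReal_le_ofReal (hg ω x)

/-- The constant in the bound for a single bandwidth. -/
noncomputable def errorConst (d : ℕ) (α L β v τ C₁ C₂ C₃ : ℝ) : ℝ :=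
  C₁ * C₃ * (d ^ strictFloor α * L + 2 * (∑' k, chainTerm d β k + 1) * √v) +
    noiseConst d C₁ C₂ C₃ * τ

lemma errorConst_nonneg (d : ℕ) (α β v : ℝ) (hL : 0 ≤ L) (hτ : 0 ≤ τ) (hC₁ : 0 ≤ C₁)
    (hC₂ : 0 ≤ C₂) (hC₃ : 0 ≤ C₃) : 0 ≤ errorConst d α L β v τ C₁ C₂ C₃ := by
  have := noiseConst_nonneg d C₁ C₃ hC₂
  have : 0 ≤ ∑' k, chainTerm d β k := tsum_nonneg (chainTerm_nonneg d β)
  unfold errorConst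
  positivity

lemma add_le_errorConst_mul_max (d : ℕ) (α β v : ℝ) (hL : 0 ≤ L) (hτ : 0 ≤ τ) (hC₁ : 0 ≤ C₁)
    (hC₂ : 0 ≤ C₂) (hC₃ : 0 ≤ C₃) (x y z : ℝ) :
    C₁ * C₃ * (d ^ strictFloor α * L * x + 2 * (∑' k, chainTerm d β k + 1) * √v * z) +
        noiseConst d C₁ C₂ C₃ * (τ * max y z) ≤
      errorConst d α L β v τ C₁ C₂ C₃ * max x (max y z) := by
  have := noiseConst_nonneg d C₁ C₃ hC₂
  have : 0 ≤ ∑' k, chainTerm d β k := tsum_nonneg (chainTerm_nonneg d β)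
  set ρ := max x (max y z)
  calc _ ≤ C₁ * C₃ * (d ^ strictFloor α * L * ρ + 2 * (∑' k, chainTerm d β k + 1) * √v * ρ) +
          noiseConst d C₁ C₂ C₃ * (τ * ρ) := by
        gcongr
        · exact le_max_left _ _
        · exact (le_max_right _ _).trans (le_max_right _ _)
        · exact le_max_right _ _
    _ = errorConst d α L β v τ C₁ C₂ C₃ * ρ := by rw [errorConst]; ring

theorem lintegral_iSup_enorm_le_errorConst_mul [IsProbabilityMeasure P] (hα : 0 < α) (hL : 0 ≤ L)
    (hβ : 0 < β) (hτ : 0 ≤ τ) (hC₁ : 0 ≤ C₁) (hC₂ : 0 ≤ C₂) (hC₃ : 0 ≤ C₃) (hn : 0 < n)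
    (hm : 1 ≤ m) (hJ : Fintype.card J ≤ m) (hh : 0 < h) (hpt : SparseDesign pt C₃ m h)
    (hw : LocalWeights pt (strictFloor α) C₁ C₂ m h w) (hZ : IndepHolderFields P β v Z)
    (hind : iIndepFun (fun ij : Fin n × J => ε ij.1 ij.2) P)
    (hε : ∀ i j, HasSubgaussianMGF (ε i j) (τ ^ 2).toNNReal P)
    (hf : f ∈ HolderClass (d := d) α L) :
    ∫⁻ ω, ⨆ x : cube d,
        ‖∑ j, w j x * (1 / (n : ℝ) * ∑ i, (f (pt j) + Z i ω (pt j) + ε i j ω)) - f x‖ₑ ∂P ≤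
      ENNReal.ofReal (errorConst d α L β v τ C₁ C₂ C₃ *
        max (h ^ α) (max (√(Real.log h⁻¹ / (n * m * h ^ d))) ((n : ℝ) ^ (-(1 / 2) : ℝ)))) := by
  obtain ⟨G, hGint, hGle, hG⟩ := hw.exists_integral_le_of_isSubgaussianVector hpt
    (.average hind hε) (by positivity) hC₂ hC₃ hm hJ hh
  rw [div_sqrt_mul_max_sqrt_log] at hG
  set b := d ^ strictFloor α * L * h ^ α
  set V : Ω → ℝ := fun ω => ‖fun j => 1 / (n : ℝ) * ∑ i, Z i ω (pt j)‖
  have hV := hZ.integral_pi_norm_average_le hβ pt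
  have hVint : Integrable V P := integrable_pi_norm fun j =>
    (integrable_finsetSum _ fun i _ => hZ.integrable i (pt j)).const_mul _
  have hbV : Integrable (fun ω => C₁ * C₃ * (b + V ω)) P :=
    ((integrable_const b).add hVint).const_mul _
  refine (lintegral_iSup_enorm_le_ofReal_integral (hbV.add hGint) fun ω x => ?_).trans
    (ENNReal.ofReal_le_ofReal ?_)
  · simp only [average_add_add hn]
    exact (abs_sum_mul_add_add_sub_le hα hL hf hw hpt hC₁ (one_pos.trans_le hm) hh _ _ x).trans
      (add_le_add_right (hGle ω x) _)
  · calc ∫ ω, (C₁ * C₃ * (b + V ω) + G ω) ∂P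
        = C₁ * C₃ * (b + ∫ ω, V ω ∂P) + ∫ ω, G ω ∂P := by
          rw [integral_add hbV hGint, integral_const_mul,
            integral_add (integrable_const b) hVint, integral_const, probReal_univ, one_smul]
      _ ≤ C₁ * C₃ * (b + 2 * (∑' k, chainTerm d β k + 1) * √v * (n : ℝ) ^ (-(1 / 2) : ℝ)) +
            noiseConst d C₁ C₂ C₃ *
              (τ * max (√(Real.log h⁻¹ / (n * m * h ^ d))) ((n : ℝ) ^ (-(1 / 2) : ℝ))) := by
          gcongr
      _ ≤ _ := add_le_errorConst_mul_max d α β v hL hτ hC₁ hC₂ hC₃ _ _ _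

end Bandwidth

/-! ### The optimal bandwidth -/

section OptimalBandwidth

open Filter

variable {d n : ℕ} {p : Fin d → ℕ} {α c : ℝ}

lemma pMin_le (p : Fin d → ℕ) (k : Fin d) : pMin p ≤ p k := ciInf_le (OrderBot.bddBelow _) k

lemma pProd_pos (hp : 0 < pMin p) : 0 < pProd p :=
  Finset.prod_pos fun k _ => hp.trans_le (pMin_le p k)

lemma card_idx (p : Fin d → ℕ) : Fintype.card (Idx p) = pProd p := by simp [pProd]

lemma hStar_rpow (hα : 0 ≤ α) (hc : 0 ≤ c) (hv : 0 ≤ Real.log (n * pProd p) / (n * pProd p)) :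
    hStar α c n p ^ α = max (c ^ α * (pMin p : ℝ) ^ (-α))
      ((Real.log (n * pProd p) / (n * pProd p)) ^ (α / (2 * α + d))) := by
  have hp : (0 : ℝ) ≤ pMin p := Nat.cast_nonneg _
  rw [hStar, (Real.monotoneOn_rpow_Ici_of_exponent_nonneg hα).map_max
    (Set.mem_Ici.2 (by positivity)) (Set.mem_Ici.2 (by positivity)), Real.div_rpow hc hp,
    Real.rpow_neg hp, ← Real.rpow_mul hv, one_div_mul_eq_div, div_eq_mul_inv (c ^ α)]

variable {m : ℝ}

lemma log_inv_le_log_div (hα : 0 < α) (hm : 0 < m) (hlog : 1 ≤ Real.log m) {h : ℝ}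
    (hh : (Real.log m / m) ^ (1 / (2 * α + d)) ≤ h) :
    Real.log h⁻¹ ≤ Real.log m / (2 * α + d) := by
  calc Real.log h⁻¹ ≤ Real.log ((Real.log m / m) ^ (1 / (2 * α + d)))⁻¹ := by
        have : 0 < h := lt_of_lt_of_le (by positivity) hh
        gcongr
    _ = (Real.log m - Real.log (Real.log m)) / (2 * α + d) := by
        rw [Real.log_inv, Real.log_rpow (by positivity), Real.log_div (by positivity) hm.ne']
        ring
    _ ≤ Real.log m / (2 * α + d) := by
        gcongr
        exact sub_le_self _ (Real.log_nonneg hlog)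

lemma log_div_mul_pow_eq_sq (hα : 0 < α) (hm : 0 < m) (hlog : 1 ≤ Real.log m) :
    Real.log m / (m * ((Real.log m / m) ^ (1 / (2 * α + d))) ^ d) =
      ((Real.log m / m) ^ (α / (2 * α + d))) ^ 2 := by
  have hv : 0 < Real.log m / m := by positivity
  rw [← div_div, div_eq_iff (by positivity), ← Real.rpow_mul_natCast hv.le,
    ← Real.rpow_mul_natCast hv.le, ← Real.rpow_add hv]
  have hexp : α / (2 * α + d) * (2 : ℕ) + 1 / (2 * α + d) * d = 1 := by
    push_cast
    field_simp
  rw [hexp, Real.rpow_one]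

lemma sqrt_log_inv_div_le (hα : 0 < α) (hm : 0 < m) (hlog : 1 ≤ Real.log m) {h : ℝ}
    (hh : (Real.log m / m) ^ (1 / (2 * α + d)) ≤ h) :
    √(Real.log h⁻¹ / (m * h ^ d)) ≤
      √(1 / (2 * α + d)) * (Real.log m / m) ^ (α / (2 * α + d)) := by
  rw [← Real.sqrt_sq (by positivity : 0 ≤ (Real.log m / m) ^ (α / (2 * α + d))),
    ← Real.sqrt_mul (by positivity), ← log_div_mul_pow_eq_sq hα hm hlog]
  refine Real.sqrt_le_sqrt ?_
  calc Real.log h⁻¹ / (m * h ^ d) ≤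
        Real.log m / (2 * α + d) / (m * ((Real.log m / m) ^ (1 / (2 * α + d))) ^ d) := by
        refine div_le_div₀ (by positivity) (log_inv_le_log_div hα hm hlog hh) (by positivity) ?_
        gcongr
    _ = _ := by ring

lemma rate_hStar_le (hα : 0 < α) (hc : 0 ≤ c) (hm : 0 < (n : ℝ) * pProd p)
    (hlog : 1 ≤ Real.log (n * pProd p)) :
    rate α n p (hStar α c n p) ≤ (c ^ α + 1 + √(1 / (2 * α + d))) * optimalRate α n p := by
  set v := Real.log (n * pProd p) / (n * pProd p)
  set o := optimalRate α n p
  have hbias : (pMin p : ℝ) ^ (-α) ≤ o := le_max_left _ _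
  have hstochastic : v ^ (α / (2 * α + d)) ≤ o := (le_max_left _ _).trans (le_max_right _ _)
  have hprocess : (n : ℝ) ^ (-(1 / 2) : ℝ) ≤ o := (le_max_right _ _).trans (le_max_right _ _)
  have ho0 : 0 ≤ o := le_trans (by positivity) hbias
  have hc0 : 0 ≤ c ^ α * o := by positivity
  have hq0 : 0 ≤ √(1 / (2 * α + d)) * o := by positivity
  rw [add_mul, add_mul, one_mul]
  refine max_le ?_ (max_le ?_ (by linarith))
  · rw [hStar_rpow hα.le hc (by positivity)]
    have : c ^ α * (pMin p : ℝ) ^ (-α) ≤ c ^ α * o := by gcongr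
    exact max_le (by linarith) (by linarith)
  · have hsqrt := sqrt_log_inv_div_le (d := d) hα hm hlog
      (le_max_right (c / (pMin p : ℝ)) _)
    have : √(1 / (2 * α + d)) * v ^ (α / (2 * α + d)) ≤ √(1 / (2 * α + d)) * o := by gcongr
    exact hsqrt.trans (by linarith)

lemma eventually_log_div_le {η : ℝ} (hη : 0 < η) : ∀ᶠ x : ℝ in atTop, Real.log x / x ≤ η := by
  have hlim : Tendsto (fun x : ℝ => Real.log x / x) atTop (nhds 0) := by
    simpa using Real.tendsto_pow_log_div_mul_add_atTop 1 0 1 one_ne_zero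
  exact hlim.eventually_le_const hη

lemma eventually_hStar_le (d : ℕ) {η : ℝ} (hα : 0 < α) (hη : 0 < η) :
    ∀ᶠ N : ℕ in atTop, ∀ (n : ℕ) (p : Fin d → ℕ), N ≤ n → N ≤ pMin p →
      hStar α c n p ≤ η ∧ 1 ≤ Real.log (n * pProd p) := by
  have hlog : ∀ᶠ N : ℕ in atTop, ∀ x : ℝ, N ≤ x →
      Real.log x / x ≤ η ^ (2 * α + d) ∧ 1 ≤ Real.log x :=
    tendsto_natCast_atTop_atTop.eventually <| eventually_forall_ge_atTop.2 <|
      (eventually_log_div_le (by positivity)).and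
        (Real.tendsto_log_atTop.eventually_ge_atTop 1)
  filter_upwards [hlog, eventually_ge_atTop 1,
    tendsto_natCast_atTop_atTop.eventually_ge_atTop (c / η)] with N hN hN1 hNc n p hn hp
  have hp0 : 0 < pMin p := hN1.trans hp
  have hNp : (N : ℝ) ≤ pMin p := Nat.cast_le.2 hp
  have hNm : (N : ℝ) ≤ n * pProd p := by
    exact_mod_cast hn.trans (Nat.le_mul_of_pos_right n (pProd_pos hp0))
  obtain ⟨hle, hlog1⟩ := hN _ hNm
  refine ⟨max_le ?_ ?_, hlog1⟩
  · exact (div_le_comm₀ hη (Nat.cast_pos.2 hp0)).1 (hNc.trans hNp)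
  · calc (Real.log (n * pProd p) / (n * pProd p)) ^ (1 / (2 * α + d))
        ≤ (η ^ (2 * α + d)) ^ (1 / (2 * α + d)) := by gcongr
      _ = η := by rw [one_div, Real.rpow_rpow_inv hη.le (by positivity)]

end OptimalBandwidth

section ProductDesign

variable {d : ℕ} {p : Fin d → ℕ} {D : ProductDesign p} {c h₀ C₁ C₂ C₃ h : ℝ}

lemma WeightConditions.localWeights {γ : ℕ} {w : Idx p → cube d → ℝ}
    (hw : WeightConditions D γ C₁ C₂ h w) : LocalWeights D.pt γ C₁ C₂ (pProd p) h w where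
  sum_eq_one := hw.sum_eq_one
  sum_monomial := hw.sum_monomial
  vanish := hw.vanish
  abs_le := hw.abs_le
  lipschitz := hw.lipschitz

lemma DesignCondition.sparseDesign (hD : DesignCondition D c h₀ C₃) (hc : 0 ≤ c)
    (hh : h ∈ Set.Ioc (c / pMin p) h₀) : SparseDesign D.pt C₃ (pProd p) h := fun x => by
  have hh0 : 0 ≤ h := le_trans (by positivity) hh.1.le
  refine Eq.trans_le ?_ (hD h hh x)
  simp only [pi_norm_le_iff_of_nonneg hh0, Pi.sub_apply, Real.norm_eq_abs, abs_sub_le_iff,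
    sub_le_iff_le_add', and_comm, add_comm h]

lemma ModelAssumptions.hasSubgaussianMGF {n : ℕ} {Ω Ω' : Type*} [MeasurableSpace Ω]
    [MeasurableSpace Ω'] {P : Measure Ω} {P' : Measure Ω'} {ζ σ : ℝ} {Z : Ω' → cube d → ℝ}
    {Zs : Fin n → Ω → cube d → ℝ} {ε : Fin n → Idx p → Ω → ℝ}
    (hM : ModelAssumptions P P' ζ σ Z Zs ε) (i : Fin n) (j : Idx p) :
    HasSubgaussianMGF (ε i j) ((ζ * σ) ^ 2).toNNReal P := by
  refine hasSubgaussianMGF_mono (hM.subgaussian_error i j) (Real.toNNReal_le_toNNReal ?_)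
  rw [mul_pow]
  gcongr
  exact hM.variance_error i j

lemma SparseDesign.of_two_mul {J : Type*} [Finite J] {pt : J → cube d} {m : ℝ} (hh : 0 ≤ h)
    (hpt : SparseDesign pt C₃ m (2 * h)) : SparseDesign pt (2 ^ d * C₃) m h := fun x => by
  calc (Nat.card {j // ‖(pt j).1 - x.1‖ ≤ h} : ℝ)
      ≤ Nat.card {j // ‖(pt j).1 - x.1‖ ≤ 2 * h} := by
        exact_mod_cast Nat.card_mono (Set.toFinite {j | ‖(pt j).1 - x.1‖ ≤ 2 * h})
          fun j (hj : _ ≤ h) => hj.trans (by linarith)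
    _ ≤ C₃ * (2 * h) ^ d * m := hpt x
    _ = 2 ^ d * C₃ * h ^ d * m := by rw [mul_pow]; ring

lemma localWeights_hStar {n : ℕ} {α c' : ℝ} {γ : ℕ} {J : Type*} [Fintype J] {pt : J → cube d}
    {m : ℝ} {w : ℝ → J → cube d → ℝ} (hc' : c ≤ c') (hp : 0 < pMin p)
    (hle : hStar α c' n p ≤ h₀)
    (hw : ∀ h ∈ Set.Ioc (c / pMin p) h₀, LocalWeights pt γ C₁ C₂ m h (w h))
    (hwc : c' = c → LocalWeights pt γ C₁ C₂ m (c / pMin p) (w (c / pMin p))) :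
    LocalWeights pt γ C₁ C₂ m (hStar α c' n p) (w (hStar α c' n p)) := by
  have hp' : (0 : ℝ) < pMin p := Nat.cast_pos.2 hp
  have hcH : c' / pMin p ≤ hStar α c' n p := le_max_left _ _
  have hcc : c / pMin p ≤ c' / pMin p := by gcongr
  rcases (hcc.trans hcH).lt_or_eq with hlt | heq
  · exact hw _ ⟨hlt, hle⟩
  · rw [← heq] at hcH ⊢
    exact hwc (((div_le_div_iff_of_pos_right hp').1 hcH).antisymm hc')

end ProductDesign

end MeanEst

theorem theorem1_general (d : ℕ) (α L β v τ c h₀ C₁ C₂ C₃ : ℝ) (hα : 0 < α) (hL : 0 ≤ L)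
    (hβ : 0 < β) (hτ : 0 ≤ τ) (hc : 0 ≤ c) (hh₀ : 0 < h₀) (hC₁ : 0 ≤ C₁) (hC₂ : 0 ≤ C₂)
    (hC₃ : 0 ≤ C₃) :
    (∃ (K : ℝ) (N : ℕ), ∀ (n : ℕ) (p : Fin d → ℕ), N ≤ n → N ≤ pMin p →
      ∀ (pt : Idx p → cube d) (w : ℝ → Idx p → cube d → ℝ),
        (∀ h ∈ Set.Ioc (c / pMin p) h₀, SparseDesign pt C₃ (pProd p) h) →
        (∀ h ∈ Set.Ioc (c / pMin p) h₀,
          LocalWeights pt (strictFloor α) C₁ C₂ (pProd p) h (w h)) →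
      ∀ (Ω : Type*) [MeasurableSpace Ω] (P : Measure Ω) [IsProbabilityMeasure P]
        (Z : Fin n → Ω → cube d → ℝ) (ε : Fin n → Idx p → Ω → ℝ),
        IndepHolderFields P β v Z → iIndepFun (fun ij : Fin n × Idx p => ε ij.1 ij.2) P →
        (∀ i j, HasSubgaussianMGF (ε i j) (τ ^ 2).toNNReal P) →
      ∀ μ ∈ HolderClass (d := d) α L, ∀ h ∈ Set.Ioc (c / pMin p) h₀,
        ∫⁻ ω, ⨆ x : cube d, ‖linearEstimator (w h)
          (fun i j ω => μ (pt j) + Z i ω (pt j) + ε i j ω) x ω - μ x‖ₑ ∂P ≤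
            ENNReal.ofReal (K * rate α n p h)) ∧
    (∀ c' : ℝ, c ≤ c' → ∃ (K : ℝ) (N : ℕ), ∀ (n : ℕ) (p : Fin d → ℕ), N ≤ n → N ≤ pMin p →
      ∀ (pt : Idx p → cube d) (w : ℝ → Idx p → cube d → ℝ),
        (∀ h ∈ Set.Ioc (c / pMin p) h₀, SparseDesign pt C₃ (pProd p) h) →
        (∀ h ∈ Set.Ioc (c / pMin p) h₀,
          LocalWeights pt (strictFloor α) C₁ C₂ (pProd p) h (w h)) →
        (c' = c → LocalWeights pt (strictFloor α) C₁ C₂ (pProd p) (c / pMin p)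
          (w (c / pMin p))) →
      ∀ (Ω : Type*) [MeasurableSpace Ω] (P : Measure Ω) [IsProbabilityMeasure P]
        (Z : Fin n → Ω → cube d → ℝ) (ε : Fin n → Idx p → Ω → ℝ),
        IndepHolderFields P β v Z → iIndepFun (fun ij : Fin n × Idx p => ε ij.1 ij.2) P →
        (∀ i j, HasSubgaussianMGF (ε i j) (τ ^ 2).toNNReal P) →
      ∀ μ ∈ HolderClass (d := d) α L,
        ∫⁻ ω, ⨆ x : cube d, ‖linearEstimator (w (hStar α c' n p))
          (fun i j ω => μ (pt j) + Z i ω (pt j) + ε i j ω) x ω - μ x‖ₑ ∂P ≤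
            ENNReal.ofReal (K * optimalRate α n p)) := by
  refine ⟨⟨errorConst d α L β v τ C₁ C₂ C₃, 1, ?_⟩, fun c' hc' => ?_⟩
  · intro n p hn hp pt w hpt hw Ω _ P _ Z ε hZ hind hε μ hμ h hh
    exact lintegral_iSup_enorm_le_errorConst_mul hα hL hβ hτ hC₁ hC₂ hC₃ hn
      (Nat.one_le_cast.2 (pProd_pos hp)) (by rw [card_idx]) (lt_of_le_of_lt (by positivity) hh.1)
      (hpt h hh) (hw h hh) hZ hind hε hμ
  · obtain ⟨N, hN, hN1⟩ := ((eventually_hStar_le (c := c') d hα (half_pos hh₀)).and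
      (Filter.eventually_ge_atTop 1)).exists
    refine ⟨errorConst d α L β v τ C₁ C₂ (2 ^ d * C₃) * (c' ^ α + 1 + √(1 / (2 * α + d))), N, ?_⟩
    intro n p hn hp pt w hpt hw hwc Ω _ P _ Z ε hZ hind hε μ hμ
    obtain ⟨hle, hlog⟩ := hN n p hn hp
    have hm : 1 ≤ (pProd p : ℝ) := Nat.one_le_cast.2 (pProd_pos (hN1.trans hp))
    have hnm : 0 < (n : ℝ) * pProd p := mul_pos (Nat.cast_pos.2 (hN1.trans hn)) (by positivity)
    have hpos : 0 < hStar α c' n p := lt_max_of_lt_right (by positivity)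
    have hcH : c / pMin p ≤ hStar α c' n p := le_trans (by gcongr) (le_max_left _ _)
    refine (lintegral_iSup_enorm_le_errorConst_mul hα hL hβ hτ hC₁ hC₂ (by positivity)
      (hN1.trans hn) hm (by rw [card_idx]) hpos
      (SparseDesign.of_two_mul hpos.le (hpt _ ⟨by linarith, by linarith⟩))
      (localWeights_hStar hc' (hN1.trans hp) (by linarith) hw hwc) hZ hind hε hμ).trans
      (ENNReal.ofReal_le_ofReal ?_)
    exact (mul_le_mul_of_nonneg_left (rate_hStar_le hα (hc.trans hc') hnm hlog)
      (errorConst_nonneg d α β v hL hτ hC₁ hC₂ (by positivity))).trans_eq (mul_assoc _ _ _).symm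

theorem theorem1 (d : ℕ) (hd : 1 ≤ d) (α L β₀ CZ ζ σ c h₀ C₁ C₂ C₃ : ℝ)
    (hα : 0 < α) (hL : 0 < L) (hβ₀ : 0 < β₀) (hβ₀1 : β₀ ≤ 1) (hCZ : 0 < CZ)
    (hζ : 0 < ζ) (hσ : 0 ≤ σ) (hc : 0 < c) (hh₀ : 0 < h₀)
    (hC₁ : 0 < C₁) (hC₂ : 0 < C₂) (hC₃ : 0 < C₃) :
    -- the bound for all bandwidths in `(c / p_min, h₀]`
    (∃ (K : ℝ) (N : ℕ), ∀ (n : ℕ) (p : Fin d → ℕ), N ≤ n → N ≤ pMin p →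
      ∀ (D : ProductDesign p) (w : ℝ → Idx p → cube d → ℝ),
        DesignCondition D c h₀ C₃ →
        (∀ h ∈ Set.Ioc (c / pMin p) h₀, WeightConditions D (strictFloor α) C₁ C₂ h (w h)) →
      ∀ (Ω Ω' : Type*) [MeasurableSpace Ω] [MeasurableSpace Ω']
        (P : Measure Ω) [IsProbabilityMeasure P] (P' : Measure Ω') [IsProbabilityMeasure P']
        (Z : Ω' → cube d → ℝ) (Zs : Fin n → Ω → cube d → ℝ) (ε : Fin n → Idx p → Ω → ℝ),
        InProcessClass P' β₀ CZ Z → ModelAssumptions P P' ζ σ Z Zs ε →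
      ∀ μ ∈ HolderClass (d := d) α L, ∀ h ∈ Set.Ioc (c / pMin p) h₀,
        expectedSupError P D (w h) μ Zs ε ≤ ENNReal.ofReal (K * rate α n p h)) ∧
    -- the rate for the bandwidth `hStar` with a constant `c' ≥ c`; the endpoint `c / p_min` is not
    -- in the interval above, so that for `c' = c` the weight conditions are required there as well
    (∀ c' : ℝ, c ≤ c' → ∃ (K : ℝ) (N : ℕ), ∀ (n : ℕ) (p : Fin d → ℕ), N ≤ n → N ≤ pMin p →
      ∀ (D : ProductDesign p) (w : ℝ → Idx p → cube d → ℝ),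
        DesignCondition D c h₀ C₃ →
        (∀ h ∈ Set.Ioc (c / pMin p) h₀, WeightConditions D (strictFloor α) C₁ C₂ h (w h)) →
        (c' = c → WeightConditions D (strictFloor α) C₁ C₂ (c / pMin p) (w (c / pMin p))) →
      ∀ (Ω Ω' : Type*) [MeasurableSpace Ω] [MeasurableSpace Ω']
        (P : Measure Ω) [IsProbabilityMeasure P] (P' : Measure Ω') [IsProbabilityMeasure P']
        (Z : Ω' → cube d → ℝ) (Zs : Fin n → Ω → cube d → ℝ) (ε : Fin n → Idx p → Ω → ℝ),
        InProcessClass P' β₀ CZ Z → ModelAssumptions P P' ζ σ Z Zs ε →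
      ∀ μ ∈ HolderClass (d := d) α L,
        expectedSupError P D (w (hStar α c' n p)) μ Zs ε ≤
          ENNReal.ofReal (K * optimalRate α n p)) := by
  obtain ⟨⟨K, N, hK⟩, h⟩ := theorem1_general d α L β₀ (2 * CZ) (ζ * σ) c h₀ C₁ C₂ C₃ hα hL.le hβ₀
    (by positivity) hc.le hh₀ hC₁.le hC₂.le hC₃.le
  refine ⟨⟨K, N, fun n p hn hp D w hD hw Ω _ _ _ P _ _ _ Z Zs ε hZ hM => ?_⟩, fun c' hc' => ?_⟩
  · exact hK n p hn hp D.pt w (fun h hh => hD.sparseDesign hc.le hh)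
      (fun h hh => (hw h hh).localWeights) Ω P Zs ε (hM.indepHolderFields hβ₀ hZ) hM.indep_error
      hM.hasSubgaussianMGF
  · obtain ⟨K, N, hK⟩ := h c' hc'
    exact ⟨K, N, fun n p hn hp D w hD hw hwc Ω _ _ _ P _ _ _ Z Zs ε hZ hM =>
      hK n p hn hp D.pt w (fun h hh => hD.sparseDesign hc.le hh)
        (fun h hh => (hw h hh).localWeights) (fun h => (hwc h).localWeights) Ω P Zs ε
        (hM.indepHolderFields hβ₀ hZ) hM.indep_error hM.hasSubgaussianMGF⟩
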